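/- **Conventions.** The convolution of strings $x_1,\dots,x_k$ over an alphabet $\Gamma$ is the string over $(\Gamma\cup\{\#\})^k$ of length $\max_i|x_i|$ obtained by reading the $x_i$ synchronously, shorter strings being padded at the end with a new symbol $\#$. A relation on strings is *automatic* if the set of convolutions of its members is regular. An automatic relation $F$ between $k$ parameter strings and a result string is *bounded* if there is a constant $c$ such that $\bigl||y|-\max_i|x_i|\bigr|\le c$ for all $(x_1,\dots,x_k,y)\in F$. A *nondeterministic automatic register machine* (NARM) with input alphabet $\Sigma$ has a finite alphabet $\Gamma\supseteq\Sigma$, finitely many registers holding strings over $\Gamma$ (initially empty), a finite set of operations and a program, i.e. a finite list of numbered instructions of the forms: read the input into a register; write a register; assign to a register a fixed string over $\Sigma$; copy a register; $R_i\leftarrow F(R_{j_1},\dots,R_{j_k})$ with $F$ a bounded automatic relation (any $y$ related to the parameters may be assigned); unconditional jump; conditional jump on the truth value of $F(R_{j_1},\dots,R_{j_k})$, $F$ being an automatic (possibly nondeterministic) test; halt; halt and accept; halt and reject. A step is the execution of one line. An input is accepted if some computation on it halts and accepts. For $f:\mathbb N\to\mathbb R$ let $\mathrm{NAL}[f(n)]$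 be the class of languages accepted by a NARM for which there are $c>0$ and $n_0$ such that on every input of length $n\ge n_0$ every accepting computation has at most $c\,f(n)$ steps. With the same convention on accepting computations, $\mathrm{NTIME}[g(n)]$ is the class of languages accepted by a nondeterministic one-tape Turing machine (tape infinite to the right) all of whose accepting computations have $O(g(n))$ steps, and $\mathrm{NSPACE}[f(n)]$ is the class of languages accepted by a nondeterministic Turing machine with a two-way read-only input tape and a work tape all of whose accepting computations visit $O(f(n))$ cells of the work tape. **Theorem.** For every function $f:\mathbb N\to\mathbb R$ (and every finite input alphabet), $$\mathrm{NAL}[f(n)]\ \subseteq\ \mathrm{NSPACE}[f(n)]\ \cap\ \mathrm{NTIME}[(n+f(n))\,f(n)].$$ -/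

import Mathlib

namespace ARM

/-! ### Convolutions and automatic relations -/

/-- The convolution of a tuple of strings: the strings are read synchronously, symbol by symbol,
the shorter ones being padded at the end (`none` is the padding symbol `#`). Its length is the
maximum of the lengths. -/
def conv {Γ : Type} {k : ℕ} (x : Fin k → List Γ) : List (Fin k → Option Γ) :=
  (List.range (Finset.univ.sup fun i => (x i).length)).map fun j i => (x i)[j]?

/-- The language of convolutions of the members of a relation. -/
def convLanguage {Γ : Type} {k : ℕ} (S : Set (Fin k → List Γ)) : Language (Fin k → Option Γ) :=
  conv '' S

/-- A relation on strings is automatic if the set of convolutions of its members is regular. -/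
def IsAutomatic {Γ : Type} {k : ℕ} (S : Set (Fin k → List Γ)) : Prop :=
  (convLanguage S).IsRegular

/-- A bounded automatic relation between `arity` parameter strings and a result string. The
length of the parameters is the length of their convolution. -/
structure BoundedAutomaticOp (Γ : Type) where
  arity : ℕ
  rel : (Fin arity → List Γ) → List Γ → Prop
  automatic : IsAutomatic {z : Fin (arity + 1) → List Γ | rel (Fin.tail z) (z 0)}
  bounded : ∃ c : ℤ, ∀ x y, rel x y → |(y.length : ℤ) - ((conv x).length : ℤ)| ≤ c

/-- An automatic relation between `arity` parameter strings and a truth value. An ordinary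
predicate `p` is the case `rel x b ↔ (b = true ↔ p x)`. -/
structure AutomaticTest (Γ : Type) where
  arity : ℕ
  rel : (Fin arity → List Γ) → Bool → Prop
  automatic : ∀ b, IsAutomatic {x : Fin arity → List Γ | rel x b}

/-! ### Nondeterministic automatic register machines -/

/-- Instructions over input alphabet `σ`, with `k` registers, operations `op` and tests `test`.
Line numbers are positions in the program, the first line being `0`. -/
inductive Instr (σ : Type) {Γ Op Test : Type} (k : ℕ) (op : Op → BoundedAutomaticOp Γ)
    (test : Test → AutomaticTest Γ) where
  | read (i : Fin k)
  | write (i : Fin k)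
  | const (i : Fin k) (w : List σ)
  | copy (i j : Fin k)
  | apply (i : Fin k) (F : Op) (args : Fin (op F).arity → Fin k)
  | goto (line : ℕ)
  | ifGoto (F : Test) (args : Fin (test F).arity → Fin k) (line : ℕ)
  | halt
  | haltAccept
  | haltReject

/-- A nondeterministic automatic register machine with input alphabet `σ`, regarded as a subset
of the finite machine alphabet `Γ` through `emb`. -/
structure NARM (σ : Type) where
  Γ : Type
  [fintypeΓ : Fintype Γ]
  emb : σ ↪ Γ
  numReg : ℕ
  Op : Type
  [fintypeOp : Fintype Op]
  op : Op → BoundedAutomaticOp Γ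
  Test : Type
  [fintypeTest : Fintype Test]
  test : Test → AutomaticTest Γ
  program : List (Instr σ numReg op test)

inductive Status where
  | running
  | halted
  | accepted
  | rejected

namespace NARM

variable {σ : Type}

/-- A configuration: status, current line, register contents, and the strings written so far. -/
structure Config (M : NARM σ) where
  status : Status
  line : ℕ
  reg : Fin M.numReg → List M.Γ
  out : List (List M.Γ)

def init (M : NARM σ) : M.Config := ⟨.running, 0, fun _ => [], []⟩

/-- The effect of one instruction on input `x`, from a running configuration. A computation in
which an operation has no possible result is stuck. -/
def Exec (M : NARM σ) (x : List σ) (c c' : M.Config) :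
    Instr σ M.numReg M.op M.test → Prop
  | .read i => c' = { c with line := c.line + 1, reg := Function.update c.reg i (x.map M.emb) }
  | .write i => c' = { c with line := c.line + 1, out := c.out ++ [c.reg i] }
  | .const i w => c' = { c with line := c.line + 1, reg := Function.update c.reg i (w.map M.emb) }
  | .copy i j => c' = { c with line := c.line + 1, reg := Function.update c.reg i (c.reg j) }
  | .apply i F args => ∃ y, (M.op F).rel (fun a => c.reg (args a)) y ∧
      c' = { c with line := c.line + 1, reg := Function.update c.reg i y }
  | .goto l => c' = { c with line := l }
  | .ifGoto F args l => ∃ b, (M.test F).rel (fun a => c.reg (args a)) b ∧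
      c' = { c with line := if b = true then l else c.line + 1 }
  | .halt => c' = { c with status := .halted }
  | .haltAccept => c' = { c with status := .accepted }
  | .haltReject => c' = { c with status := .rejected }

/-- One step is the execution of one line of the program. -/
def Step (M : NARM σ) (x : List σ) (c c' : M.Config) : Prop :=
  c.status = .running ∧ ∃ I, M.program[c.line]? = some I ∧ M.Exec x c c' I

end NARM

/-- `r 0, …, r t` is a computation of `t` steps that starts in `c₀`. -/
def IsRun {C : Type} (step : C → C → Prop) (c₀ : C) (t : ℕ) (r : ℕ → C) : Prop :=
  r 0 = c₀ ∧ ∀ i < t, step (r i) (r (i + 1))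

namespace NARM

variable {σ : Type}

/-- `r` is an accepting computation of `t` steps on input `x`. -/
def AcceptingRun (M : NARM σ) (x : List σ) (t : ℕ) (r : ℕ → M.Config) : Prop :=
  IsRun (M.Step x) M.init t r ∧ (r t).status = .accepted

def language (M : NARM σ) : Language σ :=
  {x | ∃ t r, M.AcceptingRun x t r}

end NARM

/-- `NAL[f(n)]`: the languages accepted by a nondeterministic automatic register machine all of
whose accepting computations on inputs of length `n` have `O(f(n))` steps. -/
def NAL (σ : Type) (f : ℕ → ℝ) : Set (Language σ) :=
  {L | ∃ M : NARM σ, M.language = L ∧ ∃ c : ℝ, 0 < c ∧ ∃ n₀ : ℕ, ∀ x : List σ, n₀ ≤ x.length →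
    ∀ t r, M.AcceptingRun x t r → (t : ℝ) ≤ c * f x.length}

/-! ### Nondeterministic Turing machines -/

inductive Dir where
  | left
  | right
  | stay

/-- Movement on a tape that is infinite to the right. -/
def Dir.move : Dir → ℕ → ℕ
  | .left, p => p - 1
  | .right, p => p + 1
  | .stay, p => p

/-- A nondeterministic one-tape Turing machine; its tape is infinite to the right. -/
structure NTM (σ : Type) where
  Q : Type
  [fintypeQ : Fintype Q]
  Γ : Type
  [fintypeΓ : Fintype Γ]
  emb : σ ↪ Γ
  blank : Γ
  emb_ne_blank : ∀ a, emb a ≠ blank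
  start : Q
  accept : Q
  reject : Q
  accept_ne_reject : accept ≠ reject
  δ : Q → Γ → Set (Q × Γ × Dir)

namespace NTM

variable {σ : Type}

structure Config (M : NTM σ) where
  state : M.Q
  head : ℕ
  tape : ℕ → M.Γ

def init (M : NTM σ) (x : List σ) : M.Config where
  state := M.start
  head := 0
  tape := fun p => (x[p]?).elim M.blank M.emb

def Step (M : NTM σ) (c c' : M.Config) : Prop :=
  c.state ≠ M.accept ∧ c.state ≠ M.reject ∧
    ∃ q a d, (q, a, d) ∈ M.δ c.state (c.tape c.head) ∧
      c' = ⟨q, d.move c.head, Function.update c.tape c.head a⟩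

def AcceptingRun (M : NTM σ) (x : List σ) (t : ℕ) (r : ℕ → M.Config) : Prop :=
  IsRun M.Step (M.init x) t r ∧ (r t).state = M.accept

def language (M : NTM σ) : Language σ :=
  {x | ∃ t r, M.AcceptingRun x t r}

end NTM

/-- `NTIME[g(n)]`: the languages accepted by a nondeterministic one-tape Turing machine all of
whose accepting computations on inputs of length `n` have `O(g(n))` steps. -/
def NTIME (σ : Type) (g : ℕ → ℝ) : Set (Language σ) :=
  {L | ∃ M : NTM σ, M.language = L ∧ ∃ c : ℝ, 0 < c ∧ ∃ n₀ : ℕ, ∀ x : List σ, n₀ ≤ x.length →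
    ∀ t r, M.AcceptingRun x t r → (t : ℝ) ≤ c * g x.length}

/-- The cells of the read-only input tape hold the input between two end markers. -/
inductive InputSymbol (σ : Type) where
  | leftEnd
  | sym (a : σ)
  | rightEnd

/-- The content of cell `p` of the input tape, for `p ≤ |x| + 1`. -/
def inputCell {σ : Type} (x : List σ) : ℕ → InputSymbol σ
  | 0 => .leftEnd
  | p + 1 => (x[p]?).elim .rightEnd .sym

/-- A nondeterministic Turing machine with a two-way read-only input tape and one work tape,
which is infinite to the right. -/
structure OfflineNTM (σ : Type) where
  Q : Type
  [fintypeQ : Fintype Q]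
  Γ : Type
  [fintypeΓ : Fintype Γ]
  blank : Γ
  start : Q
  accept : Q
  reject : Q
  accept_ne_reject : accept ≠ reject
  δ : Q → InputSymbol σ → Γ → Set (Q × Γ × Dir × Dir)

namespace OfflineNTM

variable {σ : Type}

structure Config (M : OfflineNTM σ) where
  state : M.Q
  inputHead : ℕ
  workHead : ℕ
  work : ℕ → M.Γ

def init (M : OfflineNTM σ) : M.Config where
  state := M.start
  inputHead := 0
  workHead := 0
  work := fun _ => M.blank

/-- The input head cannot leave the cells `0, …, |x| + 1`. -/
def Step (M : OfflineNTM σ) (x : List σ) (c c' : M.Config) : Prop :=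
  c.state ≠ M.accept ∧ c.state ≠ M.reject ∧
    ∃ q a d e, (q, a, d, e) ∈ M.δ c.state (inputCell x c.inputHead) (c.work c.workHead) ∧
      c' = ⟨q, min (d.move c.inputHead) (x.length + 1), e.move c.workHead,
        Function.update c.work c.workHead a⟩

def AcceptingRun (M : OfflineNTM σ) (x : List σ) (t : ℕ) (r : ℕ → M.Config) : Prop :=
  IsRun (M.Step x) M.init t r ∧ (r t).state = M.accept

def language (M : OfflineNTM σ) : Language σ :=
  {x | ∃ t r, M.AcceptingRun x t r}

end OfflineNTM

/-- `NSPACE[f(n)]`: the languages accepted by a nondeterministic Turing machine with read-only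
input all of whose accepting computations on inputs of length `n` visit `O(f(n))` cells of the
work tape (the visited cells are those from `0` up to the largest position of the head). -/
def NSPACE (σ : Type) (f : ℕ → ℝ) : Set (Language σ) :=
  {L | ∃ M : OfflineNTM σ, M.language = L ∧ ∃ c : ℝ, 0 < c ∧ ∃ n₀ : ℕ,
    ∀ x : List σ, n₀ ≤ x.length → ∀ t r, M.AcceptingRun x t r →
      ∀ i ≤ t, (((r i).workHead + 1 : ℕ) : ℝ) ≤ c * f x.length}

end ARM

namespace ARM

/-! ### Regular languages -/

/-! A machine step relates the input, the old registers and the new registers, and a finite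
automaton can check this relation while reading them synchronously (`exists_recognizes`). An
accepting computation of `t` steps is thus a table whose rows are the successive register contents:
each pair of consecutive rows, together with the input, passes the automaton of the instruction
executed there, and the instructions form a path through the program. Since operations are bounded,
rows have at most `n + O(t)` columns (`exists_regRun_bound`). Both simulations guess this table and
check it, in different orders.

Time: the tape holds one row. A sweep from left to right guesses the next row in its place and runs
the automaton in the finite control. There are `t + 1` sweeps over `n + O(t)` cells, and `t ≤ c * f
n`.

Space: as `f n` may be smaller than `n`, not even one row can be stored, so the table is checked
column by column. Each step owns a single cell, which holds the state of its automaton. A sweep over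
these `t` cells guesses one column of the table, passing every entry on to the next cell as its old
symbol, and advances all automata by one letter; the input head moves on between sweeps.

The bounds concern all accepting computations, so wasteful guesses must not accept. In the time
simulation cells are marked once they are needed, and the final sweep requires every mark; in the
space simulation the number of cells is exactly `t`. Hence accepting Turing computations yield
accepting register computations of matching length (`timeNTM_sound`, `spaceNTM_sound`), and
conversely (`timeNTM_complete`, `spaceNTM_complete`). Both machines are instances of `Sweeper`,
whose cost is computed once in `Implements.sound`. -/

theorem isRegular_filterMap {α β : Type} {L : Language β} (h : L.IsRegular) (f : α → Option β) :
    Language.IsRegular ({w | w.filterMap f ∈ L} : Language α) := by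
  obtain ⟨S, hS, D, rfl⟩ := h
  refine ⟨S, hS, ⟨fun s a => (f a).elim s (D.step s), D.start, D.accept⟩, ?_⟩
  ext w
  have key : ∀ (w : List α) (s : S),
      w.foldl (fun s a => (f a).elim s (D.step s)) s = (w.filterMap f).foldl D.step s := by
    intro w
    induction w with
    | nil => simp
    | cons a w ih =>
      intro s
      cases hfa : f a <;> simp [hfa, ih]
  change w.foldl _ _ ∈ D.accept ↔ (w.filterMap f).foldl _ _ ∈ D.accept
  rw [key]

/-- Myhill–Nerode: a left quotient of `{w}` is empty or consists of one suffix of `w`. -/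
theorem isRegular_singleton {α : Type} (w : List α) : Language.IsRegular ({w} : Set (List α)) := by
  refine Language.IsRegular.of_finite_range_leftQuotient ?_
  refine Set.Finite.subset (((Set.finite_Iic w.length).image
    (fun m => ({w.drop m} : Set (List α)))).insert ∅) ?_
  rintro _ ⟨v, rfl⟩
  by_cases h : v <+: w
  · obtain ⟨u, rfl⟩ := h
    right
    refine ⟨v.length, by simp, ?_⟩
    ext z
    change z ∈ ({_} : Set _) ↔ v ++ z ∈ ({v ++ u} : Set _)
    simp
  · left
    ext z
    change v ++ z ∈ ({w} : Set _) ↔ z ∈ (∅ : Set _)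
    simp only [Set.mem_singleton_iff, Set.mem_empty_iff_false, iff_false]
    rintro rfl
    exact h (List.prefix_append _ _)

-- Deleting the letters that satisfy `p` must leave the empty word.
open Classical in
theorem isRegular_forall {α : Type} (p : α → Prop) :
    Language.IsRegular ({w | ∀ a ∈ w, p a} : Set (List α)) := by
  have := isRegular_filterMap (isRegular_singleton ([] : List α))
    (fun a => if p a then none else some a)
  have e : ({w | ∀ a ∈ w, p a} : Set (List α)) =
      {w | w.filterMap (fun a => if p a then none else some a) ∈ ({[]} : Set (List α))} := by
    ext w
    simp [List.filterMap_eq_nil_iff]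
  rw [e]
  exact this

/-- The string `y` followed by padding, in `m` cells. -/
def pad {Γ : Type} (m : ℕ) (y : List Γ) : List (Option Γ) :=
  (List.range m).map (y[·]?)

theorem pad_succ_nil {Γ : Type} (m : ℕ) : pad (m + 1) ([] : List Γ) = none :: pad m [] := by
  simp [pad, List.range_succ_eq_map, Function.comp_def]

theorem pad_succ_cons {Γ : Type} (m : ℕ) (a : Γ) (y : List Γ) :
    pad (m + 1) (a :: y) = some a :: pad m y := by
  simp [pad, List.range_succ_eq_map, Function.comp_def]

theorem length_pad {Γ : Type} (m : ℕ) (y : List Γ) : (pad m y).length = m := by simp [pad]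

theorem reduceOption_pad {Γ : Type} (m : ℕ) (y : List Γ) (h : y.length ≤ m) :
    (pad m y).reduceOption = y := by
  induction m generalizing y with
  | zero => simpa [pad, eq_comm] using h
  | succ m ih =>
    cases y with
    | nil => rw [pad_succ_nil, List.reduceOption_cons_of_none, ih _ (by simp)]
    | cons a y => rw [pad_succ_cons, List.reduceOption_cons_of_some, ih _ (by simpa using h)]

/-- The padded strings. -/
def padded (Γ : Type) : Language (Option Γ) :=
  {v | ∃ m y, y.length ≤ m ∧ v = pad m y}

theorem none_cons_mem_padded {Γ : Type} (v : List (Option Γ)) :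
    none :: v ∈ padded Γ ↔ ∀ b ∈ v, b = none := by
  constructor
  · rintro ⟨m, y, h, e⟩
    cases m with
    | zero => simp [pad] at e
    | succ m =>
      cases y with
      | nil =>
        rw [pad_succ_nil] at e
        rw [(List.cons.inj e).2]
        simp [pad]
      | cons a y => simp [pad_succ_cons] at e
  · intro h
    refine ⟨v.length + 1, [], by simp, ?_⟩
    rw [List.eq_replicate_of_mem h]
    simp [pad, List.eq_replicate_iff]

theorem some_cons_mem_padded {Γ : Type} (a : Γ) (v : List (Option Γ)) :
    some a :: v ∈ padded Γ ↔ v ∈ padded Γ := by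
  constructor
  · rintro ⟨m, y, h, e⟩
    cases m with
    | zero => simp [pad] at e
    | succ m =>
      cases y with
      | nil => simp [pad_succ_nil] at e
      | cons a y =>
        rw [pad_succ_cons] at e
        exact ⟨m, y, by simpa using h, (List.cons.inj e).2⟩
  · rintro ⟨m, y, h, rfl⟩
    exact ⟨m + 1, a :: y, by simpa using h, (pad_succ_cons ..).symm⟩

/-- `some false` is the state inside the string, `some true` the one inside the padding. -/
def paddedDFA (Γ : Type) : DFA (Option Γ) (Option Bool) where
  step
    | some false, some _ => some false
    | some _, none => some true
    | _, _ => none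
  start := some false
  accept := {s | s ≠ none}

/-- The three states share one induction, since the string state can pass to the padding state and
the padding state to the dead state `none`. -/
theorem paddedDFA_evalFrom {Γ : Type} (v : List (Option Γ)) :
    (paddedDFA Γ).evalFrom none v = none ∧
    ((paddedDFA Γ).evalFrom (some true) v ≠ none ↔ ∀ b ∈ v, b = none) ∧
    ((paddedDFA Γ).evalFrom (some false) v ≠ none ↔ v ∈ padded Γ) := by
  induction v with
  | nil => exact ⟨rfl, by simp, by simpa using ⟨0, [], by simp, rfl⟩⟩
  | cons b v ih =>
    obtain ⟨h1, h2, h3⟩ := ih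
    cases b with
    | none =>
      refine ⟨h1, ?_, ?_⟩
      · simpa [DFA.evalFrom_cons, paddedDFA] using h2
      · rw [none_cons_mem_padded]; exact h2
    | some a =>
      refine ⟨h1, ?_, ?_⟩
      · rw [DFA.evalFrom_cons]
        simp [paddedDFA] at h1 ⊢
        exact h1
      · rw [some_cons_mem_padded]; exact h3

theorem isRegular_padded (Γ : Type) : (padded Γ).IsRegular :=
  ⟨Option Bool, inferInstance, paddedDFA Γ, by ext v; exact (paddedDFA_evalFrom v).2.2⟩

/-! ### Convolutions -/

theorem conv_injective {Γ : Type} {k : ℕ} :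
    Function.Injective (conv : (Fin k → List Γ) → List (Fin k → Option Γ)) := by
  intro x y h
  have aux : ∀ (z : Fin k → List Γ) (i : Fin k) (j : ℕ),
      (z i)[j]? = ((conv z)[j]?).bind (· i) := by
    intro z i j
    unfold conv
    by_cases hj : j < Finset.univ.sup fun i => (z i).length
    · simp [hj]
    · have : (z i).length ≤ j :=
        (Finset.le_sup (f := fun i => (z i).length) (Finset.mem_univ i)).trans (not_lt.mp hj)
      simp [hj, this]
  funext i
  apply List.ext_getElem?
  intro j
  rw [aux x, aux y, h]

theorem conv_mem_convLanguage {Γ : Type} {k : ℕ} (S : Set (Fin k → List Γ))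
    (z : Fin k → List Γ) : conv z ∈ convLanguage S ↔ z ∈ S :=
  conv_injective.mem_set_image

theorem length_conv {Γ : Type} {k : ℕ} (z : Fin k → List Γ) :
    (conv z).length = Finset.univ.sup fun i => (z i).length := by
  simp [conv]

open Classical in
/-- Drops the letters that consist of padding symbols only. -/
noncomputable def dropPad {Γ : Type} {k : ℕ} (v : Fin k → Option Γ) : Option (Fin k → Option Γ) :=
  if v = fun _ => none then none else some v

/-- Columns of a tape, projected to the arguments of an operation, may outnumber the letters of the
convolution. All-padding letters occur exactly beyond the longest argument, so deleting them
restores it. -/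
theorem filterMap_dropPad {Γ : Type} {k : ℕ} (z : Fin k → List Γ) (N : ℕ)
    (h : ∀ i, (z i).length ≤ N) :
    ((List.range N).map fun j i => (z i)[j]?).filterMap dropPad = conv z := by
  obtain ⟨d, rfl⟩ := Nat.exists_eq_add_of_le
    (Finset.sup_le (s := Finset.univ) (f := fun i => (z i).length) fun i _ => h i)
  rw [List.range_add, List.map_append, List.filterMap_append]
  have h1 : ∀ j ∈ List.range (Finset.univ.sup fun i => (z i).length),
      dropPad (fun i => (z i)[j]?) = some fun i => (z i)[j]? := by
    intro j hj
    rw [List.mem_range, Finset.lt_sup_iff] at hj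
    obtain ⟨i, -, hi⟩ := hj
    rw [dropPad, if_neg]
    intro e
    have := congrFun e i
    simp at this
    omega
  have h2 : ∀ j, dropPad (fun i => (z i)[(Finset.univ.sup fun i => (z i).length) + j]?) = none := by
    intro j
    rw [dropPad, if_pos]
    funext i
    have := Finset.le_sup (f := fun i => (z i).length) (Finset.mem_univ i)
    simp only [List.getElem?_eq_none_iff]
    omega
  have e1 : (List.range (Finset.univ.sup fun i => (z i).length)).filterMap
      (dropPad ∘ fun j i => (z i)[j]?) = conv z :=
    (List.filterMap_congr h1).trans (congrFun List.filterMap_eq_map' _)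
  have e2 : (List.range d).filterMap (dropPad ∘ (fun j i => (z i)[j]?) ∘
      fun j => (Finset.univ.sup fun i => (z i).length) + j) = [] :=
    List.filterMap_eq_nil_iff.2 fun j _ => h2 j
  rw [List.filterMap_map, List.map_map, List.filterMap_map, e1, e2, List.append_nil]

/-! ### Recognition of single instructions -/

namespace NARM

variable {σ : Type}

abbrev Regs (M : NARM σ) : Type := Fin M.numReg → List M.Γ

abbrev Column (M : NARM σ) : Type := Fin M.numReg → Option M.Γ

abbrev Letter (M : NARM σ) : Type := Option σ × M.Column × M.Column

/-- The symbols in position `j` of the registers. -/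
def colAt {M : NARM σ} (c : M.Regs) (j : ℕ) : M.Column := fun r => (c r)[j]?

/-- The effect of an instruction on the registers; a test has to have the truth value `b`. -/
def RegExec (M : NARM σ) (x : List σ) (b : Bool) (c c' : M.Regs) :
    Instr σ M.numReg M.op M.test → Prop
  | .read i => c' = Function.update c i (x.map M.emb)
  | .const i w => c' = Function.update c i (w.map M.emb)
  | .copy i j => c' = Function.update c i (c j)
  | .apply i F args => ∃ y, (M.op F).rel (fun a => c (args a)) y ∧ c' = Function.update c i y
  | .ifGoto F args _ => (M.test F).rel (fun a => c (args a)) b ∧ c' = c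
  | _ => c' = c

/-- The input, the old columns and the new columns, read synchronously. -/
def letters {M : NARM σ} (N : ℕ) (x : List σ) (c : M.Regs) (v : ℕ → M.Column) : List M.Letter :=
  (List.range N).map fun j => (x[j]?, colAt c j, v j)

/-- The language `K` describes the relation `R` between input, old registers and new registers. -/
def Recognizes (M : NARM σ) (K : Language M.Letter) (R : List σ → M.Regs → M.Regs → Prop) : Prop :=
  ∀ N x c v, x.length ≤ N → (∀ r, (c r).length ≤ N) →
    (letters N x c v ∈ K ↔ ∃ c', (∀ r, (c' r).length ≤ N) ∧ (∀ j < N, v j = colAt c' j) ∧ R x c c')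

theorem eq_of_getElem?_eq {α : Type} {N : ℕ} {y z : List α} (hy : y.length ≤ N)
    (hz : z.length ≤ N) (h : ∀ j < N, y[j]? = z[j]?) : y = z := by
  apply List.ext_getElem?
  intro j
  by_cases hj : j < N
  · exact h j hj
  · rw [List.getElem?_eq_none (by omega), List.getElem?_eq_none (by omega)]

theorem colAt_update {M : NARM σ} (c : M.Regs) (i : Fin M.numReg) (y : List M.Γ) (j : ℕ) :
    colAt (Function.update c i y) j = Function.update (colAt c j) i y[j]? := by
  funext r
  by_cases h : r = i
  · subst h; simp [colAt]
  · simp [colAt, h]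

theorem letters_congr {M : NARM σ} {N : ℕ} {x : List σ} {c : M.Regs} {v v' : ℕ → M.Column}
    (h : ∀ j < N, v j = v' j) : letters N x c v = letters N x c v' := by
  simp only [letters]
  apply List.map_congr_left
  intro j hj
  rw [h j (List.mem_range.1 hj)]

theorem letters_mem_forall {M : NARM σ} {N : ℕ} {x : List σ} {c : M.Regs} {v : ℕ → M.Column}
    {p : M.Letter → Prop} :
    letters N x c v ∈ ({w | ∀ a ∈ w, p a} : Language M.Letter) ↔
      ∀ j < N, p (x[j]?, colAt c j, v j) := by
  change (∀ a ∈ letters N x c v, p a) ↔ _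
  simp [letters, -Prod.forall]

theorem letters_mem_filterMap {M : NARM σ} {N : ℕ} {x : List σ} {c : M.Regs} {v : ℕ → M.Column}
    {β : Type} {L : Language β} {f : M.Letter → Option β} :
    letters N x c v ∈ ({w | w.filterMap f ∈ L} : Language M.Letter) ↔
      (List.range N).filterMap (fun j => f (x[j]?, colAt c j, v j)) ∈ L := by
  change (letters N x c v).filterMap f ∈ L ↔ _
  rw [letters, List.filterMap_map]
  rfl

theorem recognizes_id (M : NARM σ) {K : Language M.Letter} {p : List σ → M.Regs → Prop}
    (hK : ∀ N x c, x.length ≤ N → (∀ r, (c r).length ≤ N) →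
      (letters N x c (colAt c) ∈ K ↔ p x c)) :
    M.Recognizes ({w | ∀ a ∈ w, a.2.2 = a.2.1} ⊓ K) fun x c c' => p x c ∧ c' = c := by
  intro N x c v hx hc
  have h1 : letters N x c v ∈ {w : List M.Letter | ∀ a ∈ w, a.2.2 = a.2.1} ↔
      ∀ j < N, v j = colAt c j := letters_mem_forall
  change _ ∈ {w : List M.Letter | ∀ a ∈ w, a.2.2 = a.2.1} ∧ _ ∈ K ↔ _
  rw [h1]
  constructor
  · rintro ⟨h, hw⟩
    rw [letters_congr h, hK N x c hx hc] at hw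
    exact ⟨c, hc, h, hw, rfl⟩
  · rintro ⟨c', -, h, hp, rfl⟩
    refine ⟨h, ?_⟩
    rwa [letters_congr h, hK N x _ hx hc]

/-- The new columns are arbitrary guesses, so it has to be checked that track `i` spells a padded
string at all. The other tracks inherit this from the old registers, and `K` matters only for
columns of genuine strings. -/
theorem recognizes_update (M : NARM σ) (i : Fin M.numReg) {K : Language M.Letter}
    {p : List σ → M.Regs → List M.Γ → Prop}
    (hK : ∀ N x c (y : List M.Γ), x.length ≤ N → (∀ r, (c r).length ≤ N) → y.length ≤ N →
      (letters N x c (colAt (Function.update c i y)) ∈ K ↔ p x c y)) :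
    M.Recognizes ({w | ∀ a ∈ w, ∀ r ≠ i, a.2.2 r = a.2.1 r} ⊓
        ({w | w.filterMap (fun a => some (a.2.2 i)) ∈ padded M.Γ} ⊓ K))
      fun x c c' => ∃ y, p x c y ∧ c' = Function.update c i y := by
  intro N x c v hx hc
  have h1 : letters N x c v ∈ {w : List M.Letter | ∀ a ∈ w, ∀ r ≠ i, a.2.2 r = a.2.1 r} ↔
      ∀ j < N, ∀ r ≠ i, v j r = colAt c j r := letters_mem_forall
  have h2 : letters N x c v ∈ {w : List M.Letter |
        w.filterMap (fun a => some (a.2.2 i)) ∈ padded M.Γ} ↔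
      ∃ y : List M.Γ, y.length ≤ N ∧ ∀ j < N, v j i = y[j]? := by
    refine letters_mem_filterMap.trans ?_
    change List.filterMap (some ∘ fun j => v j i) _ ∈ _ ↔ _
    rw [List.filterMap_eq_map]
    constructor
    · rintro ⟨m, y, hy, e⟩
      have hm := congrArg List.length e
      rw [length_pad] at hm
      simp only [List.length_map, List.length_range] at hm
      subst hm
      refine ⟨y, hy, fun j hj => ?_⟩
      exact List.map_inj_left.1 e j (List.mem_range.2 hj)
    · rintro ⟨y, hy, h⟩
      exact ⟨N, y, hy, List.map_congr_left fun j hj => h j (List.mem_range.1 hj)⟩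
  change _ ∈ {w : List M.Letter | ∀ a ∈ w, ∀ r ≠ i, a.2.2 r = a.2.1 r} ∧
    _ ∈ {w : List M.Letter | w.filterMap (fun a => some (a.2.2 i)) ∈ padded M.Γ} ∧ _ ∈ K ↔ _
  rw [h1, h2]
  have h3 : ∀ y : List M.Γ, (∀ j < N, ∀ r ≠ i, v j r = colAt c j r) → (∀ j < N, v j i = y[j]?) →
      ∀ j < N, v j = colAt (Function.update c i y) j := by
    intro y h h' j hj
    rw [colAt_update]
    funext r
    by_cases hr : r = i
    · subst hr; simp [h' j hj]
    · simp [hr, h j hj]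
  constructor
  · rintro ⟨h, ⟨y, hy, h'⟩, hw⟩
    have hv := h3 y h h'
    rw [letters_congr hv, hK N x c y hx hc hy] at hw
    refine ⟨_, fun r => ?_, hv, y, hw, rfl⟩
    by_cases hr : r = i
    · subst hr; simpa using hy
    · simpa [hr] using hc r
  · rintro ⟨c', hc', hv, y, hp, rfl⟩
    have hy : y.length ≤ N := by simpa using hc' i
    refine ⟨fun j hj r hr => ?_, ⟨y, hy, fun j hj => ?_⟩, ?_⟩
    · rw [hv j hj, colAt_update]; simp [hr]
    · rw [hv j hj, colAt_update]; simp
    · rwa [letters_congr hv, hK N x c y hx hc hy]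

theorem exists_recognizes_update (M : NARM σ) (i : Fin M.numReg) {K : Language M.Letter}
    (hreg : K.IsRegular) {p : List σ → M.Regs → List M.Γ → Prop}
    (hK : ∀ N x c (y : List M.Γ), x.length ≤ N → (∀ r, (c r).length ≤ N) → y.length ≤ N →
      (letters N x c (colAt (Function.update c i y)) ∈ K ↔ p x c y)) :
    ∃ K : Language M.Letter, K.IsRegular ∧
      M.Recognizes K fun x c c' => ∃ y, p x c y ∧ c' = Function.update c i y :=
  ⟨_, (isRegular_forall _).inf ((isRegular_filterMap (isRegular_padded _) _).inf hreg),
    M.recognizes_update i hK⟩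

theorem exists_recognizes_id (M : NARM σ) {K : Language M.Letter} (hreg : K.IsRegular)
    {p : List σ → M.Regs → Prop}
    (hK : ∀ N x c, x.length ≤ N → (∀ r, (c r).length ≤ N) →
      (letters N x c (colAt c) ∈ K ↔ p x c)) :
    ∃ K : Language M.Letter, K.IsRegular ∧ M.Recognizes K fun x c c' => p x c ∧ c' = c :=
  ⟨_, (isRegular_forall _).inf hreg, M.recognizes_id hK⟩

theorem exists_recognizes_eq (M : NARM σ) :
    ∃ K : Language M.Letter, K.IsRegular ∧ M.Recognizes K fun _ c c' => c' = c := by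
  simpa using M.exists_recognizes_id (p := fun _ _ => True) (isRegular_forall fun _ => True)
    (fun N x c _ _ => letters_mem_forall.trans (by simp))

theorem exists_recognizes (M : NARM σ) (b : Bool) (I : Instr σ M.numReg M.op M.test) :
    ∃ K : Language M.Letter, K.IsRegular ∧
      M.Recognizes K fun x c c' => M.RegExec x b c c' I := by
  cases I with
  | read i =>
    have := M.exists_recognizes_update i (isRegular_forall fun a => a.2.2 i = a.1.map M.emb)
      (p := fun x _ y => y = x.map M.emb) (by
        intro N x c y hx hc hy
        have : (∀ j < N, y[j]? = (x[j]?).map M.emb) ↔ y = x.map M.emb :=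
          ⟨fun h => eq_of_getElem?_eq hy (by simpa using hx) (by simpa using h),
            by rintro rfl; simp⟩
        refine letters_mem_forall.trans ?_
        simpa [colAt] using this)
    simpa [RegExec] using this
  | copy i k =>
    have := M.exists_recognizes_update i (isRegular_forall fun a => a.2.2 i = a.2.1 k)
      (p := fun _ c y => y = c k) (by
        intro N x c y hx hc hy
        have : (∀ j < N, y[j]? = (c k)[j]?) ↔ y = c k :=
          ⟨fun h => eq_of_getElem?_eq hy (hc k) h, by rintro rfl; simp⟩
        refine letters_mem_forall.trans ?_
        simpa [colAt] using this)
    simpa [RegExec] using this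
  | const i w =>
    have := M.exists_recognizes_update i (isRegular_filterMap (isRegular_singleton (w.map M.emb))
      fun a => a.2.2 i) (p := fun _ _ y => y = w.map M.emb) (by
        intro N x c y hx hc hy
        refine letters_mem_filterMap.trans ?_
        have : (List.range N).filterMap (fun j => colAt (Function.update c i y) j i) =
            (pad N y).reduceOption := by
          simp only [pad, List.reduceOption, List.filterMap_map]
          simp [colAt]
        rw [this]
        rw [reduceOption_pad _ _ hy]
        rfl)
    simpa [RegExec] using this
  | apply i F args =>
    have := M.exists_recognizes_update i (isRegular_filterMap (M.op F).automatic
      fun a => dropPad (Fin.cons (a.2.2 i) fun l => a.2.1 (args l)))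
      (p := fun _ c y => (M.op F).rel (fun l => c (args l)) y) (by
        intro N x c y hx hc hy
        -- The result comes first, as in the relation whose automaticity is assumed.
        let z : Fin ((M.op F).arity + 1) → List M.Γ := Fin.cons y fun l => c (args l)
        have hz : ∀ l, (z l).length ≤ N := by
          intro l
          cases l using Fin.cases with
          | zero => exact hy
          | succ l => exact hc _
        refine letters_mem_filterMap.trans ?_
        have : (fun j => dropPad (Fin.cons (colAt (Function.update c i y) j i)
            fun l => colAt c j (args l) : Fin ((M.op F).arity + 1) → Option M.Γ)) =
            dropPad ∘ fun j l => (z l)[j]? := by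
          funext j
          refine congrArg dropPad (funext fun l => ?_)
          cases l using Fin.cases <;> simp [z, colAt]
        rw [this, ← List.filterMap_map, filterMap_dropPad z N hz, conv_mem_convLanguage]
        simp [z])
    simpa [RegExec] using this
  | ifGoto F args l =>
    exact M.exists_recognizes_id (isRegular_filterMap ((M.test F).automatic b)
      fun a => dropPad fun l => a.2.1 (args l))
      (p := fun _ c => (M.test F).rel (fun l => c (args l)) b) (by
        intro N x c hx hc
        refine letters_mem_filterMap.trans ?_
        change List.filterMap (dropPad ∘ fun j l => (c (args l))[j]?) _ ∈ convLanguage _ ↔ _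
        rw [← List.filterMap_map, filterMap_dropPad (fun l => c (args l)) N fun l => hc _,
          conv_mem_convLanguage]
        rfl)
  | write i => exact M.exists_recognizes_eq
  | goto l => exact M.exists_recognizes_eq
  | halt => exact M.exists_recognizes_eq
  | haltAccept => exact M.exists_recognizes_eq
  | haltReject => exact M.exists_recognizes_eq

end NARM

/-! ### Runs of bounded length -/

/-- From `c` there is a computation of `t` steps to a configuration with property `P`, and the
largest value of `hd` during the computation is `m`. -/
def RunTo {C : Type} (step : C → C → Prop) (P : C → Prop) (hd : C → ℕ) : ℕ → ℕ → C → Prop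
  | 0, m, c => P c ∧ m = hd c
  | t + 1, m, c => ∃ c' m', step c c' ∧ RunTo step P hd t m' c' ∧ m = max (hd c) m'

theorem IsRun.exists_runTo {C : Type} {step : C → C → Prop} {P : C → Prop} (hd : C → ℕ) {t : ℕ}
    {c : C} {r : ℕ → C} (h : IsRun step c t r) (hP : P (r t)) :
    ∃ m, RunTo step P hd t m c ∧ ∀ i ≤ t, hd (r i) ≤ m := by
  induction t generalizing c r with
  | zero =>
    obtain ⟨rfl, -⟩ := h
    exact ⟨_, ⟨hP, rfl⟩, fun i hi => by rw [Nat.le_zero.1 hi]⟩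
  | succ t ih =>
    obtain ⟨rfl, h⟩ := h
    obtain ⟨m, hm, hi⟩ := ih (c := r 1) (r := fun i => r (i + 1))
      ⟨rfl, fun i hi => h (i + 1) (by omega)⟩ hP
    refine ⟨_, ⟨_, _, h 0 (by omega), hm, rfl⟩, fun i hi' => ?_⟩
    cases i with
    | zero => exact le_max_left _ _
    | succ i => exact (hi i (by omega)).trans (le_max_right _ _)

theorem RunTo.exists_isRun {C : Type} {step : C → C → Prop} {P : C → Prop} {hd : C → ℕ}
    {t m : ℕ} {c : C} (h : RunTo step P hd t m c) : ∃ r, IsRun step c t r ∧ P (r t) := by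
  induction t generalizing c m with
  | zero => exact ⟨fun _ => c, ⟨rfl, fun i hi => by omega⟩, h.1⟩
  | succ t ih =>
    obtain ⟨c', m', hs, hr, -⟩ := h
    obtain ⟨r, ⟨h0, hr⟩, hP⟩ := ih hr
    refine ⟨fun i => Nat.casesOn i c r, ⟨rfl, fun i hi => ?_⟩, hP⟩
    cases i with
    | zero => simpa [h0] using hs
    | succ i => exact hr i (by omega)

/-- `l, ls` is a path that ends in a point satisfying `fin`. -/
def Path {Λ : Type} (next : Λ → Λ → Prop) (fin : Λ → Prop) : Λ → List Λ → Prop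
  | l, [] => fin l
  | l, l' :: ls => next l l' ∧ Path next fin l' ls

namespace NARM

variable {σ : Type} (M : NARM σ)

/-- A line number together with a truth value for the test in that line. -/
abbrev Label : Type := Fin M.program.length × Bool

def instr (l : M.Label) : Instr σ M.numReg M.op M.test := M.program[l.1]

/-- The line to be executed after `I`, where `I` is in line `p` and `b` is the outcome if `I` is
a test. -/
def nextLine (p : ℕ) (b : Bool) : Instr σ M.numReg M.op M.test → Option ℕ
  | .goto l => some l
  | .ifGoto _ _ l => some (if b = true then l else p + 1)
  | .halt => none
  | .haltAccept => none
  | .haltReject => none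
  | _ => some (p + 1)

def Next (l l' : M.Label) : Prop := M.nextLine l.1 l.2 (M.instr l) = some (l'.1 : ℕ)

def Final (l : M.Label) : Prop := M.instr l = .haltAccept

variable {M}

def maxLen (c : M.Regs) : ℕ := Finset.univ.sup fun r => (c r).length

theorem maxLen_le {c : M.Regs} {N : ℕ} : maxLen c ≤ N ↔ ∀ r, (c r).length ≤ N := by
  simp [maxLen, Finset.sup_le_iff]

theorem length_le_maxLen (c : M.Regs) (r : Fin M.numReg) : (c r).length ≤ maxLen c :=
  maxLen_le.1 le_rfl r

/-- The successive execution of labels from registers `c`. Here `H` and `H'` are the largest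
register lengths up to the beginning and up to the end. -/
def RegRun (x : List σ) : List M.Label → M.Regs → ℕ → ℕ → Prop
  | [], _, H, H' => H = H'
  | l :: ls, c, H, H' => ∃ c', M.RegExec x l.2 c c' (M.instr l) ∧ RegRun x ls c' (max H (maxLen c')) H'

/-- `H` and `H'` are bookkeeping that does not constrain the run, so each simulation may choose its
own initial value. -/
theorem RegRun.exists_of {x : List σ} {ls : List M.Label} {c : M.Regs} {H H' : ℕ}
    (h : RegRun x ls c H H') (K : ℕ) : ∃ K', RegRun x ls c K K' := by
  induction ls generalizing c H K with
  | nil => exact ⟨K, rfl⟩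
  | cons l ls ih =>
    obtain ⟨c', hc, h⟩ := h
    obtain ⟨K', hK⟩ := ih h (max K (maxLen c'))
    exact ⟨K', c', hc, hK⟩

theorem RegRun.le {x : List σ} {ls : List M.Label} {c : M.Regs} {H H' : ℕ}
    (h : RegRun x ls c H H') : H ≤ H' := by
  induction ls generalizing c H with
  | nil => exact le_of_eq h
  | cons l ls ih =>
    obtain ⟨c', -, h⟩ := h
    exact (le_max_left _ _).trans (ih h)

/-- Separates the effect on the registers from the flow of control. The outcome bit means something
for tests only and is set to `true` elsewhere. -/
theorem Exec.regExec {x : List σ} {c c' : M.Config} {I : Instr σ M.numReg M.op M.test}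
    (hc : c.status = .running) (h : M.Exec x c c' I) :
    ∃ b, M.RegExec x b c.reg c'.reg I ∧
      (c'.status = .running → M.nextLine c.line b I = some c'.line) ∧
      (c'.status = .accepted → I = .haltAccept) := by
  cases I with
  | ifGoto F args l =>
    obtain ⟨b, hb, rfl⟩ := h
    exact ⟨b, ⟨hb, rfl⟩, by simp [nextLine], by simp [hc]⟩
  | apply i F args =>
    obtain ⟨y, hy, rfl⟩ := h
    exact ⟨true, ⟨y, hy, rfl⟩, by simp [nextLine], by simp [hc]⟩
  | _ =>
    obtain rfl := h
    exact ⟨true, by simp [RegExec], by simp [nextLine], by simp [hc]⟩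

theorem RegExec.exists_exec {x : List σ} {c : M.Config} {d : M.Regs} {b : Bool} {q : ℕ}
    {I : Instr σ M.numReg M.op M.test} (h : M.RegExec x b c.reg d I)
    (hq : M.nextLine c.line b I = some q) :
    ∃ c', M.Exec x c c' I ∧ c'.status = c.status ∧ c'.line = q ∧ c'.reg = d := by
  cases I with
  | ifGoto F args l =>
    obtain ⟨hb, rfl⟩ := h
    exact ⟨_, ⟨b, hb, rfl⟩, rfl, by simpa [nextLine] using hq, rfl⟩
  | apply i F args =>
    obtain ⟨y, hy, rfl⟩ := h
    exact ⟨_, ⟨y, hy, rfl⟩, rfl, by simpa [nextLine] using hq, rfl⟩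
  | halt => simp [nextLine] at hq
  | haltAccept => simp [nextLine] at hq
  | haltReject => simp [nextLine] at hq
  | _ =>
    simp only [RegExec] at h
    subst h
    exact ⟨_, rfl, rfl, by simpa [nextLine] using hq, rfl⟩

/-- Executing the accepting halt is itself a step, so `t` steps correspond to `t` labels, the last
one being final. -/
theorem exists_path_of_runTo {x : List σ} {hd : M.Config → ℕ} {t m : ℕ} {c : M.Config}
    (hc : c.status = .running)
    (h : RunTo (M.Step x) (fun c => c.status = .accepted) hd t m c) :
    ∃ (l : M.Label) (ls : List M.Label), (l.1 : ℕ) = c.line ∧ Path M.Next M.Final l ls ∧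
      ls.length + 1 = t ∧ ∃ H', RegRun x (l :: ls) c.reg 0 H' := by
  induction t generalizing c m with
  | zero =>
    have := h.1
    simp [hc] at this
  | succ t ih =>
    obtain ⟨c', m', ⟨-, I, hI, hx⟩, hr, -⟩ := h
    obtain ⟨hlt, rfl⟩ := List.getElem?_eq_some_iff.1 hI
    obtain ⟨b, hb, hrun, hacc⟩ := hx.regExec hc
    cases t with
    | zero =>
      exact ⟨(⟨c.line, hlt⟩, b), [], rfl, hacc hr.1, rfl, _, c'.reg, hb, rfl⟩
    | succ t =>
      have hc' : c'.status = .running := by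
        obtain ⟨_, _, ⟨h, -⟩, -⟩ := hr
        exact h
      obtain ⟨l, ls, hl, hp, hlen, H', hR⟩ := ih hc' hr
      obtain ⟨K', hK⟩ := hR.exists_of (max 0 (maxLen c'.reg))
      refine ⟨(⟨c.line, hlt⟩, b), l :: ls, rfl, ⟨?_, hp⟩, by simpa using hlen, K', c'.reg, hb, hK⟩
      rw [Next, hl]
      exact hrun hc'

theorem RegRun.exists_runTo {x : List σ} {hd : M.Config → ℕ} {l : M.Label} {ls : List M.Label}
    {c : M.Config} {H H' : ℕ} (hR : RegRun x (l :: ls) c.reg H H') (hc : c.status = .running)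
    (hl : (l.1 : ℕ) = c.line) (hp : Path M.Next M.Final l ls) :
    ∃ m, RunTo (M.Step x) (fun c => c.status = .accepted) hd (ls.length + 1) m c := by
  induction ls generalizing c l H with
  | nil =>
    refine ⟨_, { c with status := .accepted }, _, ⟨hc, .haltAccept, ?_, ?_⟩, ⟨rfl, rfl⟩, rfl⟩
    · rw [← hl, List.getElem?_eq_getElem l.1.2]
      exact congrArg some hp
    · rfl
  | cons l' ls ih =>
    obtain ⟨d, hd, hR⟩ := hR
    obtain ⟨hn, hp⟩ := hp
    rw [Next, hl] at hn
    obtain ⟨c', he, hs, hl', rfl⟩ := hd.exists_exec hn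
    obtain ⟨m, hm⟩ := ih hR (hs.trans hc) hl'.symm hp
    refine ⟨_, c', m, ⟨hc, _, ?_, he⟩, hm, rfl⟩
    rw [← hl, List.getElem?_eq_getElem l.1.2]
    rfl

theorem acceptingRun_iff {x : List σ} {t : ℕ} : (∃ r, M.AcceptingRun x t r) ↔
    ∃ (l : M.Label) (ls : List M.Label), (l.1 : ℕ) = 0 ∧ Path M.Next M.Final l ls ∧
      ls.length + 1 = t ∧ ∃ H', RegRun x (l :: ls) (fun _ => []) 0 H' := by
  constructor
  · rintro ⟨r, hr, hP⟩
    obtain ⟨m, hm, -⟩ := hr.exists_runTo (P := fun c => c.status = .accepted) (fun _ => 0) hP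
    exact exists_path_of_runTo (c := M.init) rfl hm
  · rintro ⟨l, ls, hl, hp, rfl, H', hR⟩
    obtain ⟨m, hm⟩ := RegRun.exists_runTo (hd := fun _ => 0) (c := M.init) hR rfl hl hp
    exact hm.exists_isRun

/-! ### Growth of the register lengths -/

theorem maxLen_update_le (c : M.Regs) (i : Fin M.numReg) (y : List M.Γ) :
    maxLen (Function.update c i y) ≤ max (maxLen c) y.length := by
  refine maxLen_le.2 fun r => ?_
  by_cases h : r = i
  · subst h; simp
  · simpa [h] using Or.inl (length_le_maxLen c r)

theorem exists_regExec_bound (I : Instr σ M.numReg M.op M.test) :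
    ∃ C, ∀ x b (c c' : M.Regs), M.RegExec x b c c' I →
      maxLen c' ≤ max (maxLen c) x.length + C := by
  have h0 : (∀ x b (c c' : M.Regs), M.RegExec x b c c' I → c' = c) →
      ∃ C, ∀ x b (c c' : M.Regs), M.RegExec x b c c' I →
        maxLen c' ≤ max (maxLen c) x.length + C := by
    intro h
    refine ⟨0, fun x b c c' hc => ?_⟩
    rw [h x b c c' hc]
    simp
  cases I with
  | read i =>
    refine ⟨0, ?_⟩
    rintro x b c _ rfl
    simpa using maxLen_update_le c i (x.map M.emb)
  | const i w =>
    refine ⟨w.length, ?_⟩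
    rintro x b c _ rfl
    have := maxLen_update_le c i (w.map M.emb)
    rw [List.length_map] at this
    omega
  | copy i j =>
    refine ⟨0, ?_⟩
    rintro x b c _ rfl
    have := maxLen_update_le c i (c j)
    have := length_le_maxLen c j
    omega
  | apply i F args =>
    obtain ⟨C, hC⟩ := (M.op F).bounded
    refine ⟨C.toNat, ?_⟩
    rintro x b c _ ⟨y, hy, rfl⟩
    have h1 := maxLen_update_le c i y
    have h2 := abs_le.1 (hC _ _ hy)
    have h3 : (conv fun a => c (args a)).length ≤ maxLen c := by
      rw [length_conv]
      exact Finset.sup_le fun a _ => length_le_maxLen c _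
    omega
  | ifGoto F args l => exact h0 fun _ _ _ _ h => h.2
  | write i => exact h0 fun _ _ _ _ h => h
  | goto l => exact h0 fun _ _ _ _ h => h
  | halt => exact h0 fun _ _ _ _ h => h
  | haltAccept => exact h0 fun _ _ _ _ h => h
  | haltReject => exact h0 fun _ _ _ _ h => h

/-- `H` has to dominate the input as well, because reading it produces a register of that length.
`C` is the largest of the constants of the finitely many labels. -/
theorem exists_regRun_bound (M : NARM σ) : ∃ C, ∀ (x : List σ) (ls : List M.Label) (c : M.Regs)
    (H H' : ℕ), RegRun x ls c H H' → x.length ≤ H → maxLen c ≤ H → H' ≤ H + C * ls.length := by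
  choose C hC using fun l : M.Label => exists_regExec_bound (M.instr l)
  refine ⟨Finset.univ.sup C, fun x ls c H H' hR hx hc => ?_⟩
  induction ls generalizing c H with
  | nil => exact hR.ge.trans (Nat.le_add_right _ _)
  | cons l ls ih =>
    obtain ⟨c', he, hR⟩ := hR
    have h1 := hC l x l.2 c c' he
    have h2 := Finset.le_sup (f := C) (Finset.mem_univ l)
    have h3 := ih c' _ hR (hx.trans (le_max_left _ _)) (le_max_right _ _)
    rw [List.length_cons, Nat.mul_succ]
    omega

/-- A finite automaton for the execution of labels: states `Z`, start state `start l` for the label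
`l`. -/
theorem exists_automaton (M : NARM σ) : ∃ (Z : Type) (_ : Finite Z) (lab : Z → M.Label)
    (start : M.Label → Z) (step : Z → M.Letter → Z) (acc : Z → Prop),
    (∀ l, lab (start l) = l) ∧ (∀ z a, lab (step z a) = lab z) ∧
    ∀ l N x c v, x.length ≤ N → maxLen c ≤ N →
      (acc ((letters N x c v).foldl step (start l)) ↔
        ∃ c', maxLen c' ≤ N ∧ (∀ j < N, v j = colAt c' j) ∧ M.RegExec x l.2 c c' (M.instr l)) := by
  choose K hreg hK using fun l : M.Label => M.exists_recognizes l.2 (M.instr l)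
  choose S hS D hD using hreg
  -- Disjoint union of the automata of all labels: a state remembers its label, from which the
  -- successor line can be checked.
  refine ⟨Σ l, S l, inferInstance, Sigma.fst, fun l => ⟨l, (D l).start⟩,
    fun z a => ⟨z.1, (D z.1).step z.2 a⟩, fun z => z.2 ∈ (D z.1).accept, fun _ => rfl,
    fun _ _ => rfl, fun l N x c v hx hc => ?_⟩
  have key : ∀ (w : List M.Letter) (s : S l),
      w.foldl (fun (z : Σ l, S l) a => (⟨z.1, (D z.1).step z.2 a⟩ : Σ l, S l)) ⟨l, s⟩ =
        ⟨l, (D l).evalFrom s w⟩ := by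
    intro w
    induction w with
    | nil => intro s; rfl
    | cons a w ih => intro s; exact ih _
  rw [key]
  simp only [maxLen_le] at hc ⊢
  rw [← hK l N x c v hx hc, ← hD l]
  rfl

end NARM

/-! ### Sweeping machines -/

/-- A machine that prepares a row of cells over `X` and then rewrites this row again and again
from left to right, carrying an element of `Y` along. The relation `tile` may depend on a symbol
that is constant during each sweep. -/
structure Sweeper (σ X Y : Type) where
  y₀ : Y
  setup : Option σ → Y → X → Y → Prop
  turn : Y → Y → Prop
  tile : Option σ → X → Y → X → Y → Prop
  fin : Y → Prop

inductive SweepState (Y : Type) where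
  | setup (b : Bool) (y : Y)
  | back (y : Y)
  | row (y : Y)
  | accept
  | reject

/-- A `raw` cell still has its original content, `none` being the blank. The flag of a `cell` marks
the leftmost one, where the way back ends. -/
inductive SweepCell (σ X : Type) where
  | raw (r : Option σ)
  | cell (b : Bool) (x : X)
  | endMark

instance {Y : Type} [Finite Y] : Finite (SweepState Y) := by
  let f : SweepState Y → Fin 6 × Option Y
    | .setup true y => (0, some y)
    | .setup false y => (1, some y)
    | .back y => (2, some y)
    | .row y => (3, some y)
    | .accept => (4, none)
    | .reject => (5, none)
  refine Finite.of_injective f ?_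
  rintro (⟨_ | _, _⟩ | _ | _ | _ | _) (⟨_ | _, _⟩ | _ | _ | _ | _) h <;> simp_all [f]

instance {σ X : Type} [Finite σ] [Finite X] : Finite (SweepCell σ X) := by
  let f : SweepCell σ X → (Option σ ⊕ Bool × X) ⊕ Unit
    | .raw r => .inl (.inl r)
    | .cell b x => .inl (.inr (b, x))
    | .endMark => .inr ()
  refine Finite.of_injective f ?_
  rintro (_ | _ | _) (_ | _ | _) h <;> simp_all [f]

/-- A row is processed from left to right. -/
inductive Sweep {α β Y : Type} (R : α → Y → β → Y → Prop) : List α → Y → List β → Y → Prop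
  | nil (y : Y) : Sweep R [] y [] y
  | cons {a b l l' y y₁ y₂} : R a y b y₁ → Sweep R l y₁ l' y₂ → Sweep R (a :: l) y (b :: l') y₂

theorem Sweep.length_eq {α β Y : Type} {R : α → Y → β → Y → Prop} {l : List α} {y y' : Y}
    {l' : List β} (h : Sweep R l y l' y') : l'.length = l.length := by
  induction h with
  | nil => rfl
  | cons _ _ ih => simp [ih]

namespace Sweeper

variable {σ X Y C : Type} (P : Sweeper σ X Y)

/-- The transitions of the machine; the last component tells whether the next external symbol is
fetched. -/
inductive Move : SweepState Y → Option σ → SweepCell σ X →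
    SweepState Y → SweepCell σ X → Dir → Bool → Prop
  | setup {b e r y x y'} : P.setup r y x y' →
      Move (.setup b y) e (.raw r) (.setup false y') (.cell b x) .right false
  -- The end mark replaces a blank only, and only after the first cell: the row covers the input and
  -- is nonempty.
  | endMark {e y} : Move (.setup false y) e (.raw none) (.back y) .endMark .left false
  | tile {b e x y x' y'} : P.tile e x y x' y' →
      Move (.row y) e (.cell b x) (.row y') (.cell b x') .right false
  | finish {e y} : P.fin y → Move (.row y) e .endMark .accept .endMark .stay false
  | reverse {e y} : Move (.row y) e .endMark (.back y) .endMark .left false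
  | back {e y x} : Move (.back y) e (.cell false x) (.back y) (.cell false x) .left false
  | turn {e y y' x} : P.turn y y' →
      Move (.back y) e (.cell true x) (.row y') (.cell true x) .stay true

/-- `mk` embeds the configurations of the sweeping machine (state, number of external symbols
fetched, head position, tape) into those of a given machine. -/
structure Implements (ext : ℕ → Option σ) (step : C → C → Prop) (acc : C → Prop) (hd : C → ℕ)
    (mk : SweepState Y → ℕ → ℕ → (ℕ → SweepCell σ X) → C) : Prop where
  step_iff : ∀ q k p τ c', step (mk q k p τ) c' ↔ ∃ q' a d b,
    P.Move q (ext k) (τ p) q' a d b ∧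
      c' = mk q' (k + b.toNat) (d.move p) (Function.update τ p a)
  acc_iff : ∀ q k p τ, acc (mk q k p τ) ↔ q = .accept
  hd_eq : ∀ q k p τ, hd (mk q k p τ) = p

/-- Acceptance in exactly `K` sweeps, if the row is `w` and the carry `y`. -/
def Good (ext : ℕ → Option σ) : ℕ → ℕ → List X → Y → Prop
  | 0, _, _, _ => False
  -- The turn fetches a symbol before the sweep, which therefore sees entry `k + 1`.
  | K + 1, k, w, y => ∃ y₁ w' y', P.turn y y₁ ∧ Sweep (P.tile (ext (k + 1))) w y₁ w' y' ∧
      ((K = 0 ∧ P.fin y') ∨ Good ext K (k + 1) w' y')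

def IsTape (τ : ℕ → SweepCell σ X) (w : List X) : Prop :=
  (∀ i x, w[i]? = some x → τ i = .cell (decide (i = 0)) x) ∧ τ w.length = .endMark

def IsSetupTape (x₀ : List σ) (τ : ℕ → SweepCell σ X) (w : List X) : Prop :=
  (∀ i x, w[i]? = some x → τ i = .cell (decide (i = 0)) x) ∧ ∀ i, w.length ≤ i → τ i = .raw x₀[i]?

variable {P}

theorem IsTape.update {τ : ℕ → SweepCell σ X} {pre rest : List X} {x : X}
    (h : IsTape τ (pre ++ x :: rest)) (x' : X) :
    IsTape (Function.update τ pre.length (.cell (decide (pre.length = 0)) x'))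
      (pre ++ x' :: rest) := by
  refine ⟨fun i z hz => ?_, ?_⟩
  · by_cases hi : i = pre.length
    · subst hi
      simp at hz
      simp [hz]
    · rw [Function.update_of_ne hi]
      apply h.1
      rw [← hz, List.getElem?_append, List.getElem?_append]
      split_ifs with h'
      · rfl
      · obtain ⟨d, hd⟩ : ∃ d, i - pre.length = d + 1 := ⟨i - pre.length - 1, by omega⟩
        simp [hd]
  · have := h.2
    rw [Function.update_of_ne (by simp)]
    simpa using this

theorem IsSetupTape.update {x₀ : List σ} {τ : ℕ → SweepCell σ X} {pre : List X}
    (h : IsSetupTape x₀ τ pre) (x : X) :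
    IsSetupTape x₀ (Function.update τ pre.length (.cell (decide (pre.length = 0)) x))
      (pre ++ [x]) := by
  refine ⟨fun i z hz => ?_, fun i hi => ?_⟩
  · by_cases hi : i = pre.length
    · subst hi
      simp at hz
      simp [hz]
    · rw [Function.update_of_ne hi]
      apply h.1
      obtain ⟨hlt, -⟩ := List.getElem?_eq_some_iff.1 hz
      rw [List.length_append, List.length_singleton] at hlt
      rwa [List.getElem?_append_left (by omega)] at hz
  · rw [List.length_append, List.length_singleton] at hi
    rw [Function.update_of_ne (by omega)]
    exact h.2 i (by omega)

theorem IsSetupTape.endMark {x₀ : List σ} {τ : ℕ → SweepCell σ X} {w : List X}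
    (h : IsSetupTape x₀ τ w) : IsTape (Function.update τ w.length .endMark) w := by
  refine ⟨fun i z hz => ?_, by simp⟩
  obtain ⟨hlt, -⟩ := List.getElem?_eq_some_iff.1 hz
  rw [Function.update_of_ne (by omega)]
  exact h.1 i z hz

/-! ### Soundness: decomposing an accepting run into sweeps -/

namespace Implements

variable {ext : ℕ → Option σ} {step : C → C → Prop} {acc : C → Prop} {hd : C → ℕ}
  {mk : SweepState Y → ℕ → ℕ → (ℕ → SweepCell σ X) → C}

theorem exists_move (h : P.Implements ext step acc hd mk) {q : SweepState Y}
    (hq : q ≠ .accept) {T m k p : ℕ} {τ : ℕ → SweepCell σ X}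
    (hr : RunTo step acc hd T m (mk q k p τ)) : ∃ T' m' q' a d b, T = T' + 1 ∧ m = max p m' ∧
      P.Move q (ext k) (τ p) q' a d b ∧
      RunTo step acc hd T' m' (mk q' (k + b.toNat) (d.move p) (Function.update τ p a)) := by
  cases T with
  | zero => exact absurd ((h.acc_iff ..).1 hr.1) hq
  | succ T =>
    obtain ⟨c', m', hs, hr, hm⟩ := hr
    obtain ⟨q', a, d, b, hmove, rfl⟩ := (h.step_iff ..).1 hs
    exact ⟨T, m', q', a, d, b, rfl, by rw [hm, h.hd_eq], hmove, hr⟩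

theorem row_sound (h : P.Implements ext step acc hd mk) {k : ℕ} (rest : List X) :
    ∀ {pre : List X} {y : Y} {T m : ℕ} {τ : ℕ → SweepCell σ X}, IsTape τ (pre ++ rest) →
      RunTo step acc hd T m (mk (.row y) k pre.length τ) →
      ∃ rest' y' τ' T' m', Sweep (P.tile (ext k)) rest y rest' y' ∧ IsTape τ' (pre ++ rest') ∧
        T = T' + rest.length ∧
        RunTo step acc hd T' m' (mk (.row y') k (pre.length + rest.length) τ') ∧
        m ≤ max m' (pre.length + rest.length) := by
  induction rest with
  | nil =>
    intro pre y T m τ hτ hr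
    exact ⟨[], y, τ, T, m, .nil y, hτ, rfl, hr, le_max_left _ _⟩
  | cons x rest ih =>
    intro pre y T m τ hτ hr
    obtain ⟨T', m', q', a, d, b, rfl, rfl, hmove, hr⟩ := h.exists_move (by simp) hr
    rw [hτ.1 pre.length x (by simp)] at hmove
    cases hmove with
    | @tile _ _ _ _ x' y' ht =>
      have hr' : RunTo step acc hd T' m' (mk (.row y') k (pre ++ [x']).length
          (Function.update τ pre.length (.cell (decide (pre.length = 0)) x'))) := by
        rw [List.length_append]; exact hr
      obtain ⟨rest', y'', τ', T'', m'', hs, hτ', rfl, hr'', hm⟩ := ih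
        (by simpa using hτ.update x') hr'
      refine ⟨x' :: rest', y'', τ', T'', m'', .cons ht hs, by simpa using hτ', ?_, ?_, ?_⟩
      · simp; omega
      · convert hr'' using 2
        simp; omega
      · simp at hm ⊢; omega

theorem back_sound (h : P.Implements ext step acc hd mk) {k : ℕ} {y : Y} {w : List X}
    {τ : ℕ → SweepCell σ X} (hτ : IsTape τ w) {p : ℕ} :
    ∀ {T m : ℕ}, p < w.length → RunTo step acc hd T m (mk (.back y) k p τ) →
      ∃ y' T' m', P.turn y y' ∧ T = T' + (p + 1) ∧
        RunTo step acc hd T' m' (mk (.row y') (k + 1) 0 τ) ∧ m ≤ max m' p := by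
  induction p with
  | zero =>
    intro T m hp hr
    obtain ⟨T', m', q', a, d, b, rfl, hm, hmove, hr⟩ := h.exists_move (by simp) hr
    have e := hτ.1 0 w[0] (by simp)
    rw [e] at hmove
    cases hmove with
    | turn ht =>
      refine ⟨_, T', m', ht, rfl, ?_, by omega⟩
      simp only [decide_true] at e
      rw [← e, Function.update_eq_self] at hr
      exact hr
  | succ p ih =>
    intro T m hp hr
    obtain ⟨T', m', q', a, d, b, rfl, rfl, hmove, hr⟩ := h.exists_move (by simp) hr
    have e := hτ.1 (p + 1) w[p + 1] (by simp)
    have e' : decide (p + 1 = 0) = false := by simp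
    rw [e, e'] at hmove
    cases hmove with
    | back =>
      rw [e'] at e
      rw [← e, Function.update_eq_self] at hr
      obtain ⟨y', T'', m'', ht, rfl, hr', hm⟩ := ih (by omega) hr
      exact ⟨y', T'', m'', ht, by omega, hr', by omega⟩

theorem setup_sound (h : P.Implements ext step acc hd mk) {x₀ : List σ} {T : ℕ} :
    ∀ {pre : List X} {y : Y} {m : ℕ} {τ : ℕ → SweepCell σ X}, IsSetupTape x₀ τ pre →
      RunTo step acc hd T m (mk (.setup (decide (pre.length = 0)) y) 0 pre.length τ) →
      ∃ w y' τ' T' m', Sweep P.setup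
        ((List.range w.length).map fun j => x₀[pre.length + j]?) y w y' ∧
        x₀.length ≤ pre.length + w.length ∧ 0 < pre.length + w.length ∧ IsTape τ' (pre ++ w) ∧
        T = T' + w.length + 1 ∧
        RunTo step acc hd T' m' (mk (.back y') 0 (pre.length + w.length - 1) τ') ∧
        m ≤ max m' (pre.length + w.length) := by
  induction T with
  | zero =>
    intro pre y m τ hτ hr
    have := (h.acc_iff ..).1 hr.1
    simp at this
  | succ T ih =>
    intro pre y m τ hτ hr
    obtain ⟨T', m', q', a, d, b, hT, rfl, hmove, hr⟩ := h.exists_move (by simp) hr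
    obtain rfl : T = T' := by omega
    have e := hτ.2 pre.length le_rfl
    rw [e] at hmove
    generalize hb : decide (pre.length = 0) = b' at hmove
    generalize hx : x₀[pre.length]? = r at hmove
    cases hmove with
    | @setup _ _ _ _ x y' hs =>
      subst hb
      have hr' : RunTo step acc hd T m' (mk (.setup (decide ((pre ++ [x]).length = 0)) y') 0
          (pre ++ [x]).length
          (Function.update τ pre.length (.cell (decide (pre.length = 0)) x))) := by
        have : decide ((pre ++ [x]).length = 0) = false := by simp
        rw [this, List.length_append]
        exact hr
      obtain ⟨w, y'', τ', T', m'', hsw, h1, h2, hτ', rfl, hr'', hm⟩ := ih (hτ.update x) hr'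
      refine ⟨x :: w, y'', τ', T', m'', ?_, ?_, by simp, by simpa using hτ', ?_, ?_, ?_⟩
      · rw [List.length_cons, List.range_succ_eq_map, List.map_cons, List.map_map]
        refine .cons (by simpa [hx] using hs) ?_
        convert hsw using 3
        simp [Nat.add_assoc, Nat.add_comm 1]
      · simp at h1 ⊢; omega
      · rw [List.length_cons]; omega
      · convert hr'' using 2
        simp [Nat.add_assoc, Nat.add_comm 1]
      · simp at hm ⊢; omega
    | endMark =>
      have hpos : pre.length ≠ 0 := by simpa using hb
      refine ⟨[], y, _, T, m', .nil y, ?_, by simpa using Nat.pos_of_ne_zero hpos, ?_, rfl, hr, ?_⟩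
      · simpa using List.getElem?_eq_none_iff.1 hx
      · simpa using hτ.endMark
      · simpa using le_total _ _

/-- A round takes `w.length` steps back including the turn, `w.length` tiles and one step on the end
mark. -/
theorem good_of_back (h : P.Implements ext step acc hd mk) (T : ℕ) :
    ∀ {k m : ℕ} {w : List X} {y : Y} {τ : ℕ → SweepCell σ X}, 0 < w.length → IsTape τ w →
      RunTo step acc hd T m (mk (.back y) k (w.length - 1) τ) →
      ∃ K, P.Good ext K k w y ∧ T = K * (2 * w.length + 1) ∧ m ≤ w.length := by
  induction T using Nat.strong_induction_on with
  | _ T ih =>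
    intro k m w y τ hw hτ hr
    obtain ⟨y₁, T₁, m₁, hturn, rfl, hr, hm₁⟩ := h.back_sound hτ (by omega) hr
    obtain ⟨w', y', τ', T₂, m₂, hsw, hτ', rfl, hr, hm₂⟩ := h.row_sound w (pre := []) hτ hr
    have hlen := hsw.length_eq
    simp only [List.nil_append, List.length_nil, zero_add] at hτ' hr hm₂
    obtain ⟨T', m', q', a, d, b, rfl, rfl, hmove, hr⟩ := h.exists_move (by simp) hr
    have e : τ' w.length = .endMark := by rw [← hlen]; exact hτ'.2
    rw [e] at hmove
    cases hmove with
    | finish hfin =>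
      refine ⟨1, ⟨y₁, w', y', hturn, hsw, .inl ⟨rfl, hfin⟩⟩, ?_⟩
      -- The accepting state has no moves, so the run ends here.
      cases T' with
      | zero =>
        have := hr.2
        rw [h.hd_eq] at this
        simp only [Dir.move] at this
        omega
      | succ T' =>
        obtain ⟨c', m'', hs, -⟩ := hr
        obtain ⟨_, _, _, _, hmove, -⟩ := (h.step_iff ..).1 hs
        cases hmove
    | reverse =>
      rw [← e, Function.update_eq_self] at hr
      obtain ⟨K, hK, hT, hm⟩ := ih T' (by omega) (by omega) hτ' (by rw [hlen]; exact hr)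
      refine ⟨K + 1, ⟨y₁, w', y', hturn, hsw, .inr hK⟩, ?_, by omega⟩
      rw [hlen] at hT
      rw [Nat.succ_mul]
      omega

/-- The setup adds `w.length + 1` steps to the `K` rounds, and the head never passes the end mark in
cell `w.length`. -/
theorem sound (h : P.Implements ext step acc hd mk) {x₀ : List σ} {T m : ℕ}
    (hr : RunTo step acc hd T m (mk (.setup true P.y₀) 0 0 fun p => .raw x₀[p]?)) :
    ∃ w y K, x₀.length ≤ w.length ∧ 0 < w.length ∧
      Sweep P.setup ((List.range w.length).map fun j => x₀[j]?) P.y₀ w y ∧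
      P.Good ext K 0 w y ∧ T ≤ 2 * (w.length + 1) * (K + 1) ∧ m ≤ w.length := by
  obtain ⟨w, y, τ, T', m', hsw, h1, h2, hτ, rfl, hr, hm⟩ := h.setup_sound (x₀ := x₀) (pre := [])
    ⟨by simp, by simp⟩ hr
  simp only [List.nil_append, List.length_nil, zero_add] at *
  obtain ⟨K, hK, hT, hm'⟩ := h.good_of_back T' h2 hτ hr
  refine ⟨w, y, K, h1, h2, hsw, hK, ?_, by omega⟩
  rw [hT]
  nlinarith

/-! ### Completeness: accepting runs from successful sweeps -/

theorem runTo_of_move (h : P.Implements ext step acc hd mk) {q q' : SweepState Y} {k p : ℕ}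
    {τ : ℕ → SweepCell σ X} {a : SweepCell σ X} {d : Dir} {b : Bool}
    (hmove : P.Move q (ext k) (τ p) q' a d b)
    (hr : ∃ T m, RunTo step acc hd T m (mk q' (k + b.toNat) (d.move p) (Function.update τ p a))) :
    ∃ T m, RunTo step acc hd T m (mk q k p τ) := by
  obtain ⟨T, m, hr⟩ := hr
  exact ⟨T + 1, _, _, m, (h.step_iff ..).2 ⟨_, _, _, _, hmove, rfl⟩, hr, rfl⟩

/-- Phrased backwards: acceptance from the end of the row gives acceptance from its beginning.
Phases then chain by implication, without concatenating runs. -/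
theorem row_complete (h : P.Implements ext step acc hd mk) {k : ℕ} {rest rest' : List X} {y y' : Y}
    (hs : Sweep (P.tile (ext k)) rest y rest' y') :
    ∀ {pre : List X} {τ : ℕ → SweepCell σ X}, IsTape τ (pre ++ rest) →
      ∃ τ', IsTape τ' (pre ++ rest') ∧
        ((∃ T m, RunTo step acc hd T m (mk (.row y') k (pre.length + rest.length) τ')) →
          ∃ T m, RunTo step acc hd T m (mk (.row y) k pre.length τ)) := by
  induction hs with
  | nil y => exact fun {pre τ} hτ => ⟨τ, hτ, id⟩
  | @cons x x' rest rest' y y₁ y₂ ht _ ih =>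
    intro pre τ hτ
    obtain ⟨τ', hτ', hr⟩ := ih (pre := pre ++ [x'])
      (τ := Function.update τ pre.length (.cell (decide (pre.length = 0)) x'))
      (by simpa using hτ.update x')
    refine ⟨τ', by simpa using hτ', fun hacc => ?_⟩
    have e₁ : pre.length + (x :: rest).length = (pre ++ [x']).length + rest.length := by
      simp; omega
    rw [e₁] at hacc
    have := hr hacc
    rw [List.length_append] at this
    refine h.runTo_of_move (q' := .row y₁) (d := .right) (b := false) ?_ this
    rw [hτ.1 pre.length x (by simp)]
    exact .tile ht

theorem back_complete (h : P.Implements ext step acc hd mk) {k : ℕ} {y y' : Y} {w : List X}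
    {τ : ℕ → SweepCell σ X} (hτ : IsTape τ w) (ht : P.turn y y') {p : ℕ} (hp : p < w.length)
    (hr : ∃ T m, RunTo step acc hd T m (mk (.row y') (k + 1) 0 τ)) :
    ∃ T m, RunTo step acc hd T m (mk (.back y) k p τ) := by
  induction p with
  | zero =>
    have e := hτ.1 0 w[0] (by simp)
    refine h.runTo_of_move (q' := .row y') (a := τ 0) (d := .stay) (b := true) ?_ ?_
    · rw [e]; exact .turn ht
    · rw [Function.update_eq_self]; exact hr
  | succ p ih =>
    have e := hτ.1 (p + 1) w[p + 1] (by simp)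
    refine h.runTo_of_move (q' := .back y) (a := τ (p + 1)) (d := .left) (b := false) ?_ ?_
    · rw [e]; exact .back
    · rw [Function.update_eq_self]; exact ih (by omega)

theorem setup_complete (h : P.Implements ext step acc hd mk) {x₀ : List σ} (w : List X) :
    ∀ {pre : List X} {y y' : Y} {τ : ℕ → SweepCell σ X}, IsSetupTape x₀ τ pre →
      x₀.length ≤ pre.length + w.length → 0 < pre.length + w.length →
      Sweep P.setup ((List.range w.length).map fun j => x₀[pre.length + j]?) y w y' →
      ∃ τ', IsTape τ' (pre ++ w) ∧
        ((∃ T m, RunTo step acc hd T m (mk (.back y') 0 (pre.length + w.length - 1) τ')) →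
          ∃ T m, RunTo step acc hd T m
            (mk (.setup (decide (pre.length = 0)) y) 0 pre.length τ)) := by
  induction w with
  | nil =>
    intro pre y y' τ hτ h1 h2 hs
    cases hs
    refine ⟨_, by simpa using hτ.endMark, fun hr => ?_⟩
    refine h.runTo_of_move (q' := .back y) (d := .left) (b := false) ?_ hr
    simp only [List.length_nil, add_zero] at h1 h2
    rw [hτ.2 _ le_rfl, List.getElem?_eq_none h1]
    have : decide (pre.length = 0) = false := by simp; rintro rfl; simp at h2
    rw [this]
    exact .endMark
  | cons x w ih =>
    intro pre y y' τ hτ h1 h2 hs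
    rw [List.length_cons, List.range_succ_eq_map, List.map_cons, List.map_map] at hs
    cases hs with
    | @cons _ _ _ _ _ y₁ _ hx hs =>
      obtain ⟨τ', hτ', hr⟩ := ih (pre := pre ++ [x]) (y := y₁) (y' := y') (hτ.update x)
        (by simp at h1 ⊢; omega) (by simp)
        (by convert hs using 3; simp [Nat.add_assoc, Nat.add_comm 1])
      refine ⟨τ', by simpa using hτ', fun hacc => ?_⟩
      have e₁ : pre.length + (x :: w).length = (pre ++ [x]).length + w.length := by
        simp; omega
      rw [e₁] at hacc
      have := hr hacc
      have e₂ : decide ((pre ++ [x]).length = 0) = false := by simp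
      rw [e₂, List.length_append] at this
      refine h.runTo_of_move (q' := .setup false y₁) (d := .right) (b := false) ?_ this
      rw [hτ.2 _ le_rfl]
      exact .setup hx

theorem back_of_good (h : P.Implements ext step acc hd mk) {K : ℕ} :
    ∀ {k : ℕ} {w : List X} {y : Y} {τ : ℕ → SweepCell σ X}, 0 < w.length → IsTape τ w →
      P.Good ext K k w y → ∃ T m, RunTo step acc hd T m (mk (.back y) k (w.length - 1) τ) := by
  induction K with
  | zero => exact fun _ _ hK => hK.elim
  | succ K ih =>
    intro k w y τ hw hτ ⟨y₁, w', y', hturn, hsw, hK⟩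
    have hlen := hsw.length_eq
    obtain ⟨τ', hτ', hr⟩ := h.row_complete hsw (pre := []) hτ
    refine h.back_complete hτ hturn (by omega) (hr ?_)
    simp only [List.nil_append, List.length_nil, zero_add] at hτ' ⊢
    have e : τ' w.length = .endMark := by rw [← hlen]; exact hτ'.2
    rcases hK with ⟨-, hfin⟩ | hK
    · refine h.runTo_of_move (q' := .accept) (a := .endMark) (d := .stay) (b := false) ?_
        ⟨0, _, (h.acc_iff ..).2 rfl, rfl⟩
      rw [e]
      exact .finish hfin
    · refine h.runTo_of_move (q' := .back y') (a := τ' w.length) (d := .left) (b := false) ?_ ?_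
      · rw [e]; exact .reverse
      · rw [Function.update_eq_self]
        have := ih (by omega) hτ' hK
        rw [hlen] at this
        exact this

theorem complete (h : P.Implements ext step acc hd mk) {x₀ : List σ} {w : List X} {y : Y} {K : ℕ}
    (h1 : x₀.length ≤ w.length) (h2 : 0 < w.length)
    (hs : Sweep P.setup ((List.range w.length).map fun j => x₀[j]?) P.y₀ w y)
    (hK : P.Good ext K 0 w y) :
    ∃ T m, RunTo step acc hd T m (mk (.setup true P.y₀) 0 0 fun p => .raw x₀[p]?) := by
  obtain ⟨τ, hτ, hr⟩ := h.setup_complete (x₀ := x₀) w (pre := []) (y := P.y₀) (y' := y)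
    (τ := fun p => .raw x₀[p]?) ⟨by simp, by simp⟩ (by simpa using h1) (by simpa using h2)
    (by simpa using hs)
  refine hr ?_
  simp only [List.nil_append, List.length_nil, zero_add] at hτ ⊢
  exact h.back_of_good h2 hτ hK

end Implements

/-! ### Realization of sweepers by Turing machines -/

def _root_.ARM.InputSymbol.toOption : InputSymbol σ → Option σ
  | .sym a => some a
  | _ => none

/-- The symbols that an input head moving to the right from the left end marker reads. -/
def inputExt (x : List σ) (k : ℕ) : Option σ := (inputCell x (min k (x.length + 1))).toOption

/-- The shift by one is due to the left end marker, where the head starts; past the input it rests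
on the right end marker, which also reads as `none`. -/
theorem inputExt_succ (x : List σ) (k : ℕ) : inputExt x (k + 1) = x[k]? := by
  have h : ∀ j, (inputCell x (j + 1)).toOption = x[j]? := by
    intro j
    simp only [inputCell]
    cases x[j]? <;> rfl
  rw [inputExt, Nat.add_min_add_right, h]
  rcases le_total k x.length with hk | hk
  · rw [min_eq_left hk]
  · rw [min_eq_right hk, List.getElem?_eq_none le_rfl, List.getElem?_eq_none hk]

variable [Finite σ] [Finite X] [Finite Y]

/-- The one-tape machine that implements a sweeper without external symbols. -/
noncomputable def toNTM (P : Sweeper σ X Y) : NTM σ where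
  Q := SweepState Y
  fintypeQ := Fintype.ofFinite _
  Γ := SweepCell σ X
  fintypeΓ := Fintype.ofFinite _
  emb := ⟨fun a => .raw (some a), fun a b h => by simpa using h⟩
  blank := .raw none
  emb_ne_blank a h := by cases h
  start := .setup true P.y₀
  accept := .accept
  reject := .reject
  accept_ne_reject := by simp
  δ q g := {s | ∃ b, P.Move q none g s.1 s.2.1 s.2.2 b}

theorem toNTM_implements (P : Sweeper σ X Y) :
    P.Implements (fun _ => none) P.toNTM.Step (fun c => c.state = P.toNTM.accept)
      NTM.Config.head (fun q _ p τ => ⟨q, p, τ⟩) where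
  step_iff q k p τ c' := by
    constructor
    · rintro ⟨-, -, q', a, d, ⟨b, hb⟩, rfl⟩
      exact ⟨q', a, d, b, hb, rfl⟩
    · rintro ⟨q', a, d, b, hb, rfl⟩
      refine ⟨?_, ?_, q', a, d, ⟨b, hb⟩, rfl⟩
      · rintro rfl; cases hb
      · rintro rfl; cases hb
  acc_iff _ _ _ _ := Iff.rfl
  hd_eq _ _ _ _ := rfl

theorem toNTM_init (P : Sweeper σ X Y) (x : List σ) :
    P.toNTM.init x = ⟨.setup true P.y₀, 0, fun p => .raw x[p]?⟩ := by
  simp only [NTM.init, toNTM, NTM.Config.mk.injEq, true_and]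
  funext p
  cases x[p]? <;> rfl

/-- The machine with read-only input that implements a sweeper and fetches the external symbols
from the input. -/
noncomputable def toOfflineNTM (P : Sweeper σ X Y) : OfflineNTM σ where
  Q := SweepState Y
  fintypeQ := Fintype.ofFinite _
  Γ := SweepCell σ X
  fintypeΓ := Fintype.ofFinite _
  blank := .raw none
  start := .setup true P.y₀
  accept := .accept
  reject := .reject
  accept_ne_reject := by simp
  δ q i g := {s | ∃ b, P.Move q i.toOption g s.1 s.2.1 s.2.2.2 b ∧
    s.2.2.1 = if b = true then .right else .stay}

theorem toOfflineNTM_implements (P : Sweeper σ X Y) (x : List σ) :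
    P.Implements (inputExt x) (P.toOfflineNTM.Step x)
      (fun c => c.state = P.toOfflineNTM.accept) OfflineNTM.Config.workHead
      (fun q k p τ => ⟨q, min k (x.length + 1), p, τ⟩) where
  step_iff q k p τ c' := by
    have hmin : ∀ b : Bool, min ((if b = true then Dir.right else Dir.stay).move
        (min k (x.length + 1))) (x.length + 1) = min (k + b.toNat) (x.length + 1) := by
      intro b
      cases b <;> simp [Dir.move]
    constructor
    · rintro ⟨-, -, q', a, d, e, ⟨b, hb, hd⟩, rfl⟩
      simp only at hd
      subst hd
      refine ⟨q', a, e, b, hb, ?_⟩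
      rw [← hmin]
      rfl
    · rintro ⟨q', a, d, b, hb, rfl⟩
      refine ⟨?_, ?_, q', a, if b = true then .right else .stay, d, ⟨b, hb, rfl⟩, ?_⟩
      · rintro rfl; cases hb
      · rintro rfl; cases hb
      · rw [← hmin]; rfl
  acc_iff _ _ _ _ := Iff.rfl
  hd_eq _ _ _ _ := rfl

theorem toOfflineNTM_init (P : Sweeper σ X Y) (x : List σ) : P.toOfflineNTM.init =
    ⟨.setup true P.y₀, min 0 (x.length + 1), 0, fun p => .raw ([] : List σ)[p]?⟩ := by
  simp [OfflineNTM.init, toOfflineNTM]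

end Sweeper

/-! ### Simulation in bounded time -/

inductive TimeCarry (Z : Type) where
  | setup (b : Bool)
  | run (z : Z)
  | check

instance {Z : Type} [Finite Z] : Finite (TimeCarry Z) := by
  let f : TimeCarry Z → (Bool ⊕ Z) ⊕ Unit
    | .setup b => .inl (.inl b)
    | .run z => .inl (.inr z)
    | .check => .inr ()
  refine Finite.of_injective f ?_
  rintro (_ | _ | _) (_ | _ | _) h <;> simp_all [f]

namespace NARM

variable {σ : Type}

/-- An automaton for the execution of labels. -/
structure Automaton (M : NARM σ) where
  Z : Type
  [finite : Finite Z]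
  lab : Z → M.Label
  start : M.Label → Z
  step : Z → M.Letter → Z
  acc : Z → Prop
  lab_start : ∀ l, lab (start l) = l
  lab_step : ∀ z a, lab (step z a) = lab z
  acc_iff : ∀ l N x c v, x.length ≤ N → maxLen c ≤ N →
    (acc ((letters N x c v).foldl step (start l)) ↔
      ∃ c', maxLen c' ≤ N ∧ (∀ j < N, v j = colAt c' j) ∧ M.RegExec x l.2 c c' (M.instr l))

namespace Automaton

variable {M : NARM σ} (A : M.Automaton)

instance : Finite A.Z := A.finite

theorem lab_foldl (z : A.Z) (w : List M.Letter) : A.lab (w.foldl A.step z) = A.lab z := by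
  induction w generalizing z with
  | nil => rfl
  | cons a w ih => exact (ih _).trans (A.lab_step _ _)

open Classical in
/-- The registers are rewritten once for every step. A cell holds an input symbol, the symbols of
the registers, and the information whether a register has been that long or the cell is needed for
the input. The last sweep checks that all cells have been used. -/
noncomputable def timeSweeper : Sweeper σ (Option σ × M.Column × Bool) (TimeCarry A.Z) where
  y₀ := .setup true
  -- `b` is true for the first cell only, which counts as used from the start because even the empty
  -- input needs a nonempty row.
  setup r y a y' := ∃ b, y = .setup b ∧ a = (r, fun _ => none, r.isSome || b) ∧ y' = .setup false
  turn
    | .setup _, .run z => ∃ l : M.Label, (l.1 : ℕ) = 0 ∧ z = A.start l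
    | .run z, .run z' => A.acc z ∧ ∃ l, M.Next (A.lab z) l ∧ z' = A.start l
    | .run z, .check => A.acc z ∧ M.Final (A.lab z)
    | _, _ => False
  tile _ a y a' y' :=
    match y, y' with
    | .run z, .run z' => (a'.1 = a.1 ∧ a'.2.2 = (a.2.2 || decide (a'.2.1 ≠ fun _ => none))) ∧
        z' = A.step z (a.1, a.2.1, a'.2.1)
    | .check, .check => a.2.2 = true ∧ a' = a
    | _, _ => False
  fin y := y = .check

/-- The row of cells for input `x` and registers `c`; the first `H` cells have been used. -/
def timeRow (N : ℕ) (x : List σ) (c : M.Regs) (H : ℕ) : List (Option σ × M.Column × Bool) :=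
  (List.range N).map fun j => (x[j]?, colAt c j, decide (j < H))

theorem _root_.ARM.NARM.colAt_eq_none {c : M.Regs} {j : ℕ} :
    (colAt c j = fun _ => none) ↔ maxLen c ≤ j := by
  rw [maxLen_le, funext_iff]
  simp [colAt]

theorem _root_.ARM.NARM.maxLen_nil : maxLen (fun _ => [] : M.Regs) = 0 := by
  simp [maxLen]

theorem _root_.ARM.NARM.colAt_nil (j : ℕ) : colAt (fun _ => [] : M.Regs) j = fun _ => none :=
  colAt_eq_none.2 (maxLen_nil.le.trans (Nat.zero_le _))

/-! ### Single sweeps of the time simulation -/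

open Classical in
theorem sweep_run {e : Option σ} {w w' : List (Option σ × M.Column × Bool)} {z : A.Z}
    {y' : TimeCarry A.Z} : Sweep (A.timeSweeper.tile e) w (.run z) w' y' ↔
      List.Forall₂ (fun a a' => a'.1 = a.1 ∧ a'.2.2 = (a.2.2 || decide (a'.2.1 ≠ fun _ => none)))
        w w' ∧ y' = .run ((List.zipWith (fun a a' => (a.1, a.2.1, a'.2.1)) w w').foldl A.step z) := by
  induction w generalizing z w' with
  | nil =>
    constructor
    · rintro ⟨⟩
      exact ⟨.nil, rfl⟩
    · rintro ⟨⟨⟩, rfl⟩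
      exact .nil _
  | cons a w ih =>
    constructor
    · rintro (_ | ⟨ht, hs⟩)
      rename_i a' w' y₁
      cases y₁ with
      | run z₁ =>
        obtain ⟨h1, rfl⟩ := ht
        obtain ⟨h2, h3⟩ := ih.1 hs
        exact ⟨.cons h1 h2, h3⟩
      | setup b => exact ht.elim
      | check => exact ht.elim
    · rintro ⟨_ | ⟨h1, h2⟩, rfl⟩
      exact .cons (y₁ := .run _)
        (show A.timeSweeper.tile e _ (.run z) _ (.run _) from ⟨h1, rfl⟩) (ih.2 ⟨h2, rfl⟩)

theorem sweep_check {e : Option σ} {w w' : List (Option σ × M.Column × Bool)}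
    {y' : TimeCarry A.Z} : Sweep (A.timeSweeper.tile e) w .check w' y' ↔
      (∀ a ∈ w, a.2.2 = true) ∧ w' = w ∧ y' = .check := by
  induction w generalizing w' with
  | nil =>
    constructor
    · rintro ⟨⟩
      simp
    · rintro ⟨-, rfl, rfl⟩
      exact .nil _
  | cons a w ih =>
    constructor
    · rintro (_ | ⟨ht, hs⟩)
      rename_i a' w' y₁
      cases y₁ with
      | check =>
        obtain ⟨h1, rfl⟩ := ht
        obtain ⟨h2, rfl, rfl⟩ := ih.1 hs
        exact ⟨by simpa using ⟨h1, by simpa using h2⟩, rfl, rfl⟩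
      | setup b => exact ht.elim
      | run z => exact ht.elim
    · rintro ⟨h, rfl, rfl⟩
      exact .cons (y₁ := .check)
        (show A.timeSweeper.tile e _ .check _ .check from ⟨h a (by simp), rfl⟩)
        (ih.2 ⟨fun b hb => h b (by simp [hb]), rfl, rfl⟩)

theorem sweep_setup_false {L : List (Option σ)} {w : List (Option σ × M.Column × Bool)}
    {y : TimeCarry A.Z} : Sweep A.timeSweeper.setup L (.setup false) w y ↔
      w = L.map (fun r => (r, fun _ => none, r.isSome)) ∧ y = .setup false := by
  induction L generalizing w with
  | nil =>
    constructor
    · rintro ⟨⟩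
      simp
    · rintro ⟨rfl, rfl⟩
      exact .nil _
  | cons r L ih =>
    constructor
    · rintro (_ | ⟨⟨b, hb, rfl, rfl⟩, hs⟩)
      obtain ⟨rfl, rfl⟩ := ih.1 hs
      cases hb
      simp
    · rintro ⟨rfl, rfl⟩
      exact .cons ⟨false, rfl, by simp, rfl⟩ (ih.2 ⟨rfl, rfl⟩)

theorem sweep_setup {x : List σ} {N : ℕ} (hN : 0 < N) {w : List (Option σ × M.Column × Bool)}
    {y : TimeCarry A.Z} :
    Sweep A.timeSweeper.setup ((List.range N).map fun j => x[j]?) (.setup true) w y ↔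
      w = timeRow N x (fun _ => []) (max x.length 1) ∧ y = .setup false := by
  obtain ⟨N, rfl⟩ : ∃ n, N = n + 1 := ⟨N - 1, by omega⟩
  have e : timeRow (M := M) (N + 1) x (fun _ => []) (max x.length 1) =
      (x[0]?, fun _ => none, true) :: ((List.range N).map fun j => x[j + 1]?).map
        (fun r => (r, fun _ => none, r.isSome)) := by
    simp only [timeRow, List.range_succ_eq_map, List.map_cons, List.map_map]
    refine congrArg₂ _ (by simp [colAt_nil]) (List.map_congr_left fun j _ => ?_)
    refine Prod.ext rfl (Prod.ext (by simp [colAt_nil]) ?_)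
    rw [Bool.eq_iff_iff]
    simp
  rw [e, List.range_succ_eq_map, List.map_cons, List.map_map]
  constructor
  · rintro (_ | ⟨⟨b, hb, rfl, rfl⟩, hs⟩)
    obtain ⟨rfl, rfl⟩ := A.sweep_setup_false.1 hs
    cases hb
    simp [Function.comp_def]
  · rintro ⟨rfl, rfl⟩
    exact .cons ⟨true, rfl, by simp, rfl⟩ (A.sweep_setup_false.2 ⟨rfl, rfl⟩)

/-- Acceptance of the automaton is tested only at the next turn, hence the implication. Marks are
added exactly where the new column is not pure padding, which turns `H` into `max H (maxLen c')`. -/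
theorem sweep_step_sound {e : Option σ} {N H : ℕ} {x : List σ} {c : M.Regs} {l : M.Label}
    {w' : List (Option σ × M.Column × Bool)} {y' : TimeCarry A.Z} (hx : x.length ≤ N)
    (hc : maxLen c ≤ N)
    (h : Sweep (A.timeSweeper.tile e) (timeRow N x c H) (.run (A.start l)) w' y') :
    ∃ z, y' = .run z ∧ A.lab z = l ∧ (A.acc z → ∃ c', maxLen c' ≤ N ∧
      M.RegExec x l.2 c c' (M.instr l) ∧ w' = timeRow N x c' (max H (maxLen c'))) := by
  obtain ⟨h1, rfl⟩ := A.sweep_run.1 h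
  refine ⟨_, rfl, (A.lab_foldl _ _).trans (A.lab_start l), fun hacc => ?_⟩
  obtain ⟨hlen, hget⟩ := List.forall₂_iff_get.1 h1
  have hN : w'.length = N := by rw [← hlen]; simp [timeRow]
  -- The default of `getD` is never used, since all indices are below `N`.
  have e : List.zipWith (fun a a' => (a.1, a.2.1, a'.2.1)) (timeRow N x c H) w' =
      letters N x c fun j => (w'.getD j (none, fun _ => none, false)).2.1 := by
    apply List.ext_getElem
    · simp [timeRow, letters, hN]
    · intro j h1 h2
      have hj : j < w'.length := by simp at h1; omega
      simp [timeRow, letters, hj]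
  rw [e, A.acc_iff l N x c _ hx hc] at hacc
  obtain ⟨c', hc', hv, hexec⟩ := hacc
  refine ⟨c', hc', hexec, ?_⟩
  apply List.ext_getElem
  · simp [timeRow, hN]
  · intro j hj h2
    have hjN : j < N := by omega
    have h3 := hget j (by simpa [timeRow] using hjN) hj
    have h4 := hv j hjN
    simp only [List.get_eq_getElem, timeRow, List.getElem_map, List.getElem_range] at h3 ⊢
    simp only [List.getD_eq_getElem?_getD, List.getElem?_eq_getElem hj, Option.getD_some] at h4
    refine Prod.ext h3.1 (Prod.ext h4 ?_)
    rw [h3.2, Bool.eq_iff_iff]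
    simp [h4, colAt_eq_none]

theorem sweep_step_complete {e : Option σ} {N H : ℕ} {x : List σ} {c c' : M.Regs} {l : M.Label}
    (hx : x.length ≤ N) (hc : maxLen c ≤ N) (hc' : maxLen c' ≤ N)
    (h : M.RegExec x l.2 c c' (M.instr l)) :
    ∃ z, A.lab z = l ∧ A.acc z ∧ Sweep (A.timeSweeper.tile e) (timeRow N x c H)
      (.run (A.start l)) (timeRow N x c' (max H (maxLen c'))) (.run z) := by
  refine ⟨_, (A.lab_foldl _ _).trans (A.lab_start l),
    (A.acc_iff l N x c (colAt c') hx hc).2 ⟨c', hc', fun _ _ => rfl, h⟩, ?_⟩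
  rw [A.sweep_run]
  refine ⟨List.forall₂_iff_get.2 ⟨by simp [timeRow], fun j h1 h2 => ?_⟩, ?_⟩
  · simp only [timeRow, List.get_eq_getElem, List.getElem_map, List.getElem_range, true_and]
    rw [Bool.eq_iff_iff]
    simp [colAt_eq_none]
  · congr 2
    simp [timeRow, letters, List.zipWith_map]

/-! ### Whole computations in the time simulation -/

theorem acc_of_good {ext : ℕ → Option σ} {K k : ℕ} {w : List (Option σ × M.Column × Bool)}
    {z : A.Z} (h : A.timeSweeper.Good ext K k w (.run z)) : A.acc z := by
  cases K with
  | zero => exact h.elim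
  | succ K =>
    obtain ⟨y, _, _, h, -⟩ := h
    cases y with
    | setup b => exact h.elim
    | run z => exact h.1
    | check => exact h.1

/-- One sweep for each remaining label and one for the check. The check finds all `N` cells used,
whence `N ≤ H'`: a guessed row is no longer than the computation justifies. -/
theorem good_sound {ext : ℕ → Option σ} {N : ℕ} {x : List σ} (hx : x.length ≤ N) {K : ℕ} :
    ∀ {k : ℕ} {c : M.Regs} {H : ℕ} {z : A.Z}, maxLen c ≤ N →
      A.timeSweeper.Good ext K k (timeRow N x c H) (.run z) →
      ∃ ls H', Path M.Next M.Final (A.lab z) ls ∧ RegRun x ls c H H' ∧ N ≤ H' ∧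
        K = ls.length + 1 := by
  induction K with
  | zero => exact fun _ hK => hK.elim
  | succ K ih =>
    rintro k c H z hc ⟨y₁, w', y', hturn, hs, hK⟩
    cases y₁ with
    | setup b => exact hturn.elim
    | check =>
      obtain ⟨h1, rfl, rfl⟩ := A.sweep_check.1 hs
      refine ⟨[], H, hturn.2, rfl, ?_, ?_⟩
      · by_contra hH
        have := h1 (x[H]?, colAt c H, decide (H < H))
          (List.mem_map.2 ⟨H, List.mem_range.2 (by omega), rfl⟩)
        simp at this
      · rcases hK with ⟨rfl, -⟩ | hK
        · rfl
        -- No turn leads out of `check`, so no sweep can follow.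
        · cases K with
          | zero => exact hK.elim
          | succ K => obtain ⟨_, _, _, h, -⟩ := hK; exact h.elim
    | run z₁ =>
      obtain ⟨-, l, hl, rfl⟩ := hturn
      obtain ⟨z', rfl, hlab, hw⟩ := A.sweep_step_sound hx hc hs
      rcases hK with ⟨-, hfin⟩ | hK
      · cases hfin
      have hacc := A.acc_of_good hK
      obtain ⟨c', hc', hexec, rfl⟩ := hw hacc
      obtain ⟨ls, H', hp, hR, hH, rfl⟩ := ih hc' hK
      rw [hlab] at hp
      exact ⟨l :: ls, H', ⟨hl, hp⟩, ⟨c', hexec, hR⟩, hH, rfl⟩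

theorem good_complete {ext : ℕ → Option σ} {N : ℕ} {x : List σ} (hx : x.length ≤ N)
    (ls : List M.Label) :
    ∀ {k : ℕ} {c : M.Regs} {H : ℕ} {z : A.Z}, maxLen c ≤ N → A.acc z →
      Path M.Next M.Final (A.lab z) ls → RegRun x ls c H N →
      A.timeSweeper.Good ext (ls.length + 1) k (timeRow N x c H) (.run z) := by
  induction ls with
  | nil =>
    intro k c H z hc hz hp hR
    obtain rfl : H = N := hR
    refine ⟨.check, _, .check, ⟨hz, hp⟩, A.sweep_check.2 ⟨?_, rfl, rfl⟩, .inl ⟨rfl, rfl⟩⟩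
    simp [timeRow]
  | cons l ls ih =>
    rintro k c H z hc hz ⟨hn, hp⟩ ⟨c', hexec, hR⟩
    have hc' : maxLen c' ≤ N := (le_max_right _ _).trans hR.le
    obtain ⟨z', rfl, hacc, hs⟩ := A.sweep_step_complete (e := ext (k + 1)) (H := H) hx hc hc' hexec
    exact ⟨.run (A.start (A.lab z')), _, _, ⟨hz, _, hn, rfl⟩, hs, .inr (ih hc' hacc hp hR)⟩

theorem good_setup {ext : ℕ → Option σ} {N : ℕ} {x : List σ} (hx : x.length ≤ N) {K : ℕ}
    (h : A.timeSweeper.Good ext K 0 (timeRow N x (fun _ => []) (max x.length 1))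
      (.setup false)) :
    ∃ (l : M.Label) (ls : List M.Label) (H' : ℕ), (l.1 : ℕ) = 0 ∧ Path M.Next M.Final l ls ∧
      RegRun x (l :: ls) (fun _ => []) (max x.length 1) H' ∧ N ≤ H' ∧ K = ls.length + 2 := by
  cases K with
  | zero => exact h.elim
  | succ K =>
    obtain ⟨y₁, w', y', hturn, hs, hK⟩ := h
    cases y₁ with
    | setup b => exact hturn.elim
    | check => exact hturn.elim
    | run z₁ =>
      obtain ⟨l, hl, rfl⟩ := hturn
      obtain ⟨z', rfl, hlab, hw⟩ := A.sweep_step_sound hx (maxLen_nil.le.trans (Nat.zero_le _)) hs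
      rcases hK with ⟨-, hfin⟩ | hK
      · cases hfin
      have hacc := A.acc_of_good hK
      obtain ⟨c', hc', hexec, rfl⟩ := hw hacc
      obtain ⟨ls, H', hp, hR, hH, rfl⟩ := A.good_sound hx hc' hK
      rw [hlab] at hp
      exact ⟨l, ls, H', hl, hp, ⟨c', hexec, hR⟩, hH, rfl⟩

end Automaton

end NARM

/-! ### Simulation in bounded space -/

/-- `setup` remembers the preceding label, if any; `run` carries the register symbols at the current
position from one step to the next. -/
inductive SpaceCarry (Λ Col : Type) where
  | setup (p : Option Λ)
  | run (a : Col)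
  | check

instance {Λ Col : Type} [Finite Λ] [Finite Col] : Finite (SpaceCarry Λ Col) := by
  let f : SpaceCarry Λ Col → (Option Λ ⊕ Col) ⊕ Unit
    | .setup b => .inl (.inl b)
    | .run z => .inl (.inr z)
    | .check => .inr ()
  refine Finite.of_injective f ?_
  rintro (_ | _ | _) (_ | _ | _) h <;> simp_all [f]

namespace NARM.Automaton

variable {σ : Type} {M : NARM σ} (A : M.Automaton)

/-- The label of every step is guessed at the beginning, and every sweep checks one position of
the registers for all steps at once. A cell belongs to a step and holds a state of the automaton
for the label of this step. -/
def spaceSweeper : Sweeper σ A.Z (SpaceCarry M.Label M.Column) where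
  y₀ := .setup none
  setup _ y z y' := ∃ p l, y = .setup p ∧ y' = .setup (some l) ∧ z = A.start l ∧
    p.elim ((l.1 : ℕ) = 0) fun l₀ => M.Next l₀ l
  turn y y' := ((∃ l, y = .setup (some l) ∧ M.Final l) ∨ ∃ a, y = .run a) ∧
    -- All registers are empty initially, so every column of the table starts with padding.
    (y' = .run (fun _ => none) ∨ y' = .check)
  tile e z y z' y' :=
    match y, y' with
    | .run a, .run a' => z' = A.step z (e, a, a')
    -- With `e = none` the input is exhausted, so the columns already treated cover it.
    | .check, .check => (e = none ∧ A.acc z) ∧ z' = z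
    | _, _ => False
  fin y := y = .check

/-- The columns `u` can be completed to a table in which the successive rows are related as the
successive states in `w` demand. -/
def Table (xs : List (Option σ)) : List A.Z → List M.Column → Prop
  | [], _ => True
  | z :: w, u => ∃ u', u'.length = u.length ∧ A.acc ((xs.zip (u.zip u')).foldl A.step z) ∧
      Table xs w u'

/-- The entries guessed in one sweep become a new first column: each automaton has already read its
letter of this column, and the rest of the table takes over from the resulting states. -/
theorem sweep_column {e : Option σ} {w w' : List A.Z} {a : M.Column}
    {y' : SpaceCarry M.Label M.Column} (h : Sweep (A.spaceSweeper.tile e) w (.run a) w' y') :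
    (∃ a', y' = .run a') ∧ ∀ xs u, A.Table xs w' u → A.Table (e :: xs) w (a :: u) := by
  induction w generalizing a w' with
  | nil =>
    cases h
    exact ⟨⟨a, rfl⟩, fun _ _ _ => trivial⟩
  | cons z w ih =>
    obtain _ | ⟨ht, hs⟩ := h
    rename_i z' w' y₁
    cases y₁ with
    | run a₁ =>
      obtain rfl := ht
      obtain ⟨hy, ht⟩ := ih hs
      refine ⟨hy, fun xs u => ?_⟩
      rintro ⟨u', hlen, hacc, hT⟩
      exact ⟨a₁ :: u', by simp [hlen], hacc, ht _ _ hT⟩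
    | setup b => exact ht.elim
    | check => exact ht.elim

theorem Table.exists_sweep {e : Option σ} {xs : List (Option σ)} {w : List A.Z} {a : M.Column}
    {u : List M.Column} (h : A.Table (e :: xs) w (a :: u)) :
    ∃ w' a', Sweep (A.spaceSweeper.tile e) w (.run a) w' (.run a') ∧ A.Table xs w' u := by
  induction w generalizing a u with
  | nil => exact ⟨[], a, .nil _, trivial⟩
  | cons z w ih =>
    obtain ⟨_ | ⟨a₁, u'⟩, hlen, hacc, hT⟩ := h
    · simp at hlen
    · obtain ⟨w', a', hs, hT⟩ := ih hT
      exact ⟨A.step z (e, a, a₁) :: w', a', .cons (y₁ := .run a₁)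
        (show A.spaceSweeper.tile e _ (.run a) _ (.run a₁) from rfl) hs, u', by simpa using hlen,
        hacc, hT⟩

theorem table_nil {w : List A.Z} : A.Table [] w [] ↔ ∀ z ∈ w, A.acc z := by
  induction w with
  | nil => simp [Table]
  | cons z w ih =>
    rw [List.forall_mem_cons, ← ih]
    constructor
    · rintro ⟨u', hlen, hacc, hT⟩
      obtain rfl := List.eq_nil_of_length_eq_zero hlen
      exact ⟨hacc, hT⟩
    · rintro ⟨hacc, hT⟩
      exact ⟨[], rfl, hacc, hT⟩

theorem sweep_accept {e : Option σ} {w w' : List A.Z} {y' : SpaceCarry M.Label M.Column} :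
    Sweep (A.spaceSweeper.tile e) w .check w' y' ↔
      (∀ z ∈ w, e = none ∧ A.acc z) ∧ w' = w ∧ y' = .check := by
  induction w generalizing w' with
  | nil =>
    constructor
    · rintro ⟨⟩
      simp
    · rintro ⟨-, rfl, rfl⟩
      exact .nil _
  | cons a w ih =>
    constructor
    · rintro (_ | ⟨ht, hs⟩)
      rename_i a' w' y₁
      cases y₁ with
      | check =>
        obtain ⟨h1, rfl⟩ := ht
        obtain ⟨h2, rfl, rfl⟩ := ih.1 hs
        exact ⟨List.forall_mem_cons.2 ⟨h1, h2⟩, rfl, rfl⟩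
      | setup b => exact ht.elim
      | run z => exact ht.elim
    · rintro ⟨h, rfl, rfl⟩
      exact .cons (y₁ := .check)
        (show A.spaceSweeper.tile e _ .check _ .check from ⟨h a (by simp), rfl⟩)
        (ih.2 ⟨fun b hb => h b (by simp [hb]), rfl, rfl⟩)

/-- `m` counts the column sweeps; it is not bounded and costs time only. An empty `w` would pass the
check without any look at the input. -/
theorem table_of_good {ext : ℕ → Option σ} {K : ℕ} :
    ∀ {k : ℕ} {w : List A.Z} {y : SpaceCarry M.Label M.Column}, w ≠ [] →
      A.spaceSweeper.Good ext K k w y → ∃ m, ext (k + m + 1) = none ∧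
        A.Table ((List.range m).map fun j => ext (k + j + 1)) w (List.replicate m fun _ => none) := by
  induction K with
  | zero => exact fun _ h => h.elim
  | succ K ih =>
    rintro k w y hw ⟨y₁, w', y', ⟨-, rfl | rfl⟩, hs, hK⟩
    · obtain ⟨⟨a', rfl⟩, hT⟩ := A.sweep_column hs
      obtain ⟨-, hfin⟩ | hK := hK
      · cases hfin
      have hw' : w' ≠ [] := by
        rw [← List.length_pos_iff_ne_nil] at hw ⊢
        rwa [hs.length_eq]
      obtain ⟨m, hm, hT'⟩ := ih hw' hK
      refine ⟨m + 1, by rw [← hm]; congr 1; omega, ?_⟩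
      rw [List.range_succ_eq_map, List.map_cons, List.map_map, List.replicate_succ]
      refine hT _ _ ?_
      convert hT' using 3
      simp only [Function.comp_apply]
      congr 1
      omega
    · obtain ⟨h1, -, -⟩ := A.sweep_accept.1 hs
      obtain ⟨z, w, rfl⟩ := List.exists_cons_of_ne_nil hw
      exact ⟨0, (h1 z (by simp)).1, A.table_nil.2 fun z hz => (h1 z hz).2⟩

theorem Table.exists_good {ext : ℕ → Option σ} {m : ℕ} :
    ∀ {k : ℕ} {w : List A.Z} {y : SpaceCarry M.Label M.Column},
      ((∃ l, y = .setup (some l) ∧ M.Final l) ∨ ∃ a, y = .run a) → ext (k + m + 1) = none →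
      A.Table ((List.range m).map fun j => ext (k + j + 1)) w (List.replicate m fun _ => none) →
      ∃ K, A.spaceSweeper.Good ext K k w y := by
  induction m with
  | zero =>
    intro k w y hy hext hT
    exact ⟨1, .check, w, .check, ⟨hy, .inr rfl⟩,
      A.sweep_accept.2 ⟨fun z hz => ⟨hext, A.table_nil.1 hT z hz⟩, rfl, rfl⟩, .inl ⟨rfl, rfl⟩⟩
  | succ m ih =>
    intro k w y hy hext hT
    rw [List.range_succ_eq_map, List.map_cons, List.map_map, List.replicate_succ] at hT
    obtain ⟨w', a', hs, hT⟩ := hT.exists_sweep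
    obtain ⟨K, hK⟩ := ih (k := k + 1) (w := w') (y := .run a') (.inr ⟨a', rfl⟩)
      (by rw [← hext]; congr 1; omega)
      (by
        convert hT using 3
        simp only [Function.comp_apply]
        congr 1
        omega)
    exact ⟨K + 1, _, _, _, ⟨hy, .inl rfl⟩, hs, .inr hK⟩

theorem map_colAt_nil (N : ℕ) : (List.range N).map (colAt (fun _ => [] : M.Regs)) =
    List.replicate N fun _ => none := by
  rw [List.eq_replicate_iff]
  refine ⟨by simp, fun b hb => ?_⟩
  obtain ⟨j, -, rfl⟩ := List.mem_map.1 hb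
  exact colAt_nil j

theorem zip_eq_letters {N : ℕ} {x : List σ} {c : M.Regs} {v : ℕ → M.Column} :
    ((List.range N).map fun j => x[j]?).zip
      (((List.range N).map (colAt c)).zip ((List.range N).map v)) = letters N x c v := by
  simp [letters, List.zip_map']

/-- Acceptance by the automaton of a row shows that the guessed columns `u'` come from register
strings of length at most `N`, which is what the next row needs. -/
theorem Table.exists_regRun {N : ℕ} {x : List σ} (hx : x.length ≤ N) {ls : List M.Label} :
    ∀ {c : M.Regs} (H : ℕ), maxLen c ≤ N →
      A.Table ((List.range N).map fun j => x[j]?) (ls.map A.start) ((List.range N).map (colAt c)) →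
      ∃ H', RegRun x ls c H H' := by
  induction ls with
  | nil => exact fun H _ _ => ⟨H, rfl⟩
  | cons l ls ih =>
    rintro c H hc ⟨u', hlen, hacc, hT⟩
    have hu : u' = (List.range N).map fun j => u'.getD j fun _ => none := by
      apply List.ext_getElem
      · simpa using hlen
      · intro j h1 h2
        simp [h1]
    rw [hu, zip_eq_letters, A.acc_iff _ _ _ _ _ hx hc] at hacc
    obtain ⟨c', hc', hv, hexec⟩ := hacc
    have hu' : u' = (List.range N).map (colAt c') := by
      rw [hu]
      exact List.map_congr_left fun j hj => hv j (List.mem_range.1 hj)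
    rw [hu'] at hT
    obtain ⟨H', hR⟩ := ih (max H (maxLen c')) hc' hT
    exact ⟨H', c', hexec, hR⟩

theorem table_of_regRun {N : ℕ} {x : List σ} (hx : x.length ≤ N) {ls : List M.Label} :
    ∀ {c : M.Regs} {H : ℕ}, maxLen c ≤ N → RegRun x ls c H N →
      A.Table ((List.range N).map fun j => x[j]?) (ls.map A.start)
        ((List.range N).map (colAt c)) := by
  induction ls with
  | nil => exact fun _ _ => trivial
  | cons l ls ih =>
    rintro c H hc ⟨c', hexec, hR⟩
    have hc' : maxLen c' ≤ N := (le_max_right _ _).trans hR.le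
    refine ⟨(List.range N).map (colAt c'), by simp, ?_, ih hc' hR⟩
    rw [zip_eq_letters, A.acc_iff _ _ _ _ _ hx hc]
    exact ⟨c', hc', fun _ _ => rfl, hexec⟩

theorem sweep_labels {L : List (Option σ)} {w : List A.Z} {y : SpaceCarry M.Label M.Column}
    {l : M.Label} (h : Sweep A.spaceSweeper.setup L (.setup (some l)) w y) :
    ∃ ls l', w = ls.map A.start ∧ y = .setup (some l') ∧
      (M.Final l' → Path M.Next M.Final l ls) := by
  induction L generalizing l w with
  | nil =>
    cases h
    exact ⟨[], l, rfl, rfl, id⟩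
  | cons r L ih =>
    obtain _ | ⟨⟨p, l₁, hp, rfl, rfl, hn⟩, hs⟩ := h
    cases hp
    obtain ⟨ls, l', rfl, rfl, hP⟩ := ih hs
    exact ⟨l₁ :: ls, l', rfl, rfl, fun hf => ⟨hn, hP hf⟩⟩

theorem exists_sweep_labels {L : List (Option σ)} {l : M.Label} {ls : List M.Label}
    (hlen : L.length = ls.length) (h : Path M.Next M.Final l ls) :
    ∃ l', M.Final l' ∧
      Sweep A.spaceSweeper.setup L (.setup (some l)) (ls.map A.start) (.setup (some l')) := by
  induction L generalizing l ls with
  | nil =>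
    obtain rfl := List.eq_nil_of_length_eq_zero hlen.symm
    exact ⟨l, h, .nil _⟩
  | cons r L ih =>
    obtain _ | ⟨l₁, ls⟩ := ls
    · simp at hlen
    · obtain ⟨hn, hp⟩ := h
      obtain ⟨l', hf, hs⟩ := ih (by simpa using hlen) hp
      exact ⟨l', hf, .cons ⟨some l, l₁, rfl, rfl, rfl, hn⟩ hs⟩

end NARM.Automaton

/-! ### The theorem -/

namespace NARM

variable {σ : Type} {M : NARM σ}

instance : Fintype M.Γ := M.fintypeΓ

theorem exists_regRun_of_acceptingRun {x : List σ} {t : ℕ} {r : ℕ → M.Config}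
    (h : M.AcceptingRun x t r) (H : ℕ) : ∃ (l : M.Label) (ls : List M.Label) (H' : ℕ),
      (l.1 : ℕ) = 0 ∧ Path M.Next M.Final l ls ∧ ls.length + 1 = t ∧
        RegRun x (l :: ls) (fun _ => []) H H' := by
  obtain ⟨l, ls, hl, hp, hlen, H', hR⟩ := acceptingRun_iff.1 ⟨r, h⟩
  obtain ⟨K, hK⟩ := hR.exists_of H
  exact ⟨l, ls, K, hl, hp, hlen, hK⟩

theorem exists_acceptingRun_of_regRun {x : List σ} {l : M.Label} {ls : List M.Label} {H H' : ℕ}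
    (hl : (l.1 : ℕ) = 0) (hp : Path M.Next M.Final l ls)
    (hR : RegRun x (l :: ls) (fun _ => []) H H') : ∃ r, M.AcceptingRun x (ls.length + 1) r :=
  acceptingRun_iff.2 ⟨l, ls, hl, hp, rfl, hR.exists_of 0⟩

namespace Automaton

variable [Finite σ] (A : M.Automaton)

/-- With `t` steps there are `K = t + 1` sweeps, and the marks together with the growth bound limit
the row to `max x.length 1 + C * t` cells. -/
theorem timeNTM_sound {C : ℕ} (hC : ∀ (x : List σ) (ls : List M.Label) (c : M.Regs) (H H' : ℕ),
      RegRun x ls c H H' → x.length ≤ H → maxLen c ≤ H → H' ≤ H + C * ls.length)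
    {x : List σ} {T : ℕ} {R : ℕ → A.timeSweeper.toNTM.Config}
    (h : A.timeSweeper.toNTM.AcceptingRun x T R) :
    ∃ t r, M.AcceptingRun x t r ∧ 1 ≤ t ∧ T ≤ 2 * (max x.length 1 + C * t + 1) * (t + 2) := by
  obtain ⟨h, hP⟩ := h
  rw [Sweeper.toNTM_init] at h
  obtain ⟨m, hm, -⟩ := h.exists_runTo (P := fun c => c.state = A.timeSweeper.toNTM.accept)
    NTM.Config.head hP
  obtain ⟨w, y, K, h1, h2, hs, hK, hT, -⟩ := A.timeSweeper.toNTM_implements.sound hm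
  obtain ⟨hw, rfl⟩ := (A.sweep_setup h2).1 hs
  rw [hw] at hK
  obtain ⟨l, ls, H', hl, hp, hR, hN, rfl⟩ := A.good_setup h1 hK
  obtain ⟨r, hr⟩ := exists_acceptingRun_of_regRun hl hp hR
  refine ⟨_, r, hr, by omega, hT.trans ?_⟩
  have := hC _ _ _ _ _ hR (le_max_left _ _) (by simp [maxLen_nil])
  rw [List.length_cons] at this
  exact Nat.mul_le_mul (by omega) le_rfl

theorem timeNTM_complete {x : List σ} {t : ℕ} {r : ℕ → M.Config} (h : M.AcceptingRun x t r) :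
    ∃ T R, A.timeSweeper.toNTM.AcceptingRun x T R := by
  -- The row length `N` is exactly the largest length attained, so that all cells are used in the
  -- end.
  obtain ⟨l, ls, N, hl, hp, -, c', hexec, hR⟩ := exists_regRun_of_acceptingRun h (max x.length 1)
  have hN := hR.le
  have hx : x.length ≤ N := by omega
  have hc' : maxLen c' ≤ N := by omega
  obtain ⟨z, rfl, hacc, hs⟩ := A.sweep_step_complete (e := none) (H := max x.length 1) hx
    (by simp [maxLen_nil]) hc' hexec
  have hG := A.good_complete (ext := fun _ => none) hx ls (k := 1) hc' hacc hp hR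
  have hlen : (Automaton.timeRow N x (fun _ => [] : M.Regs) (max x.length 1)).length = N := by
    simp [timeRow]
  obtain ⟨T, m, hT⟩ := A.timeSweeper.toNTM_implements.complete (x₀ := x) (K := ls.length + 2)
    (by rw [hlen]; exact hx) (by rw [hlen]; omega)
    ((A.sweep_setup (by rw [hlen]; omega)).2 ⟨by rw [hlen], rfl⟩)
    ⟨.run (A.start (A.lab z)), _, _, ⟨_, hl, rfl⟩, hs, .inr hG⟩
  rw [← Sweeper.toNTM_init] at hT
  obtain ⟨R, hR⟩ := hT.exists_isRun
  exact ⟨T, R, hR⟩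

/-- The blank work tape lets the setup create any positive number of cells, but each cell stands for
one step of the simulated computation, so this number is `t`. -/
theorem spaceNTM_sound {x : List σ} {T : ℕ} {R : ℕ → A.spaceSweeper.toOfflineNTM.Config}
    (h : A.spaceSweeper.toOfflineNTM.AcceptingRun x T R) :
    ∃ t r, M.AcceptingRun x t r ∧ 1 ≤ t ∧ ∀ i ≤ T, (R i).workHead ≤ t := by
  obtain ⟨h, hP⟩ := h
  rw [Sweeper.toOfflineNTM_init _ x] at h
  obtain ⟨m, hm, hi⟩ := h.exists_runTo
    (P := fun c => c.state = A.spaceSweeper.toOfflineNTM.accept) OfflineNTM.Config.workHead hP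
  obtain ⟨w, y, K, -, h2, hs, hK, -, hmw⟩ := (A.spaceSweeper.toOfflineNTM_implements x).sound hm
  obtain ⟨N, hN, hT⟩ := A.table_of_good (List.length_pos_iff_ne_nil.1 h2) hK
  generalize hL : (List.range w.length).map (fun j => ([] : List σ)[j]?) = L at hs
  obtain _ | ⟨⟨p, l, hp, rfl, rfl, hl⟩, hs⟩ := hs
  · simp at h2
  cases hp
  obtain ⟨ls, l', rfl, rfl, hP⟩ := A.sweep_labels hs
  have hfin : M.Final l' := by
    cases K with
    | zero => exact hK.elim
    | succ K =>
      obtain ⟨_, _, _, ⟨⟨l, hl, hf⟩ | ⟨a, ha⟩, -⟩, -⟩ := hK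
      · cases hl
        exact hf
      · cases ha
  simp only [Sweeper.inputExt_succ, zero_add, List.getElem?_eq_none_iff] at hN hT
  rw [← List.map_cons, ← map_colAt_nil] at hT
  obtain ⟨H', hR⟩ := hT.exists_regRun A hN 0 (maxLen_nil.le.trans (Nat.zero_le _))
  obtain ⟨r, hr⟩ := exists_acceptingRun_of_regRun hl (hP hfin) hR
  refine ⟨_, r, hr, by omega, fun i hi' => (hi i hi').trans (hmw.trans ?_)⟩
  simp

theorem spaceNTM_complete {x : List σ} {t : ℕ} {r : ℕ → M.Config} (h : M.AcceptingRun x t r) :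
    ∃ T R, A.spaceSweeper.toOfflineNTM.AcceptingRun x T R := by
  obtain ⟨l, ls, N, hl, hp, -, hR⟩ := exists_regRun_of_acceptingRun h x.length
  have hx : x.length ≤ N := hR.le
  have hT := A.table_of_regRun hx (maxLen_nil.le.trans (Nat.zero_le _)) hR
  obtain ⟨l', hf, hs⟩ := A.exists_sweep_labels
    (L := (List.range ls.length).map fun j => ([] : List σ)[j + 1]?) (by simp) hp
  obtain ⟨K, hK⟩ := Table.exists_good A (ext := Sweeper.inputExt x) (m := N) (k := 0)
    (w := (l :: ls).map A.start) (y := .setup (some l')) (.inl ⟨l', rfl, hf⟩)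
    (by simpa [Sweeper.inputExt_succ] using hx)
    (by
      simp only [Sweeper.inputExt_succ, zero_add]
      rwa [← map_colAt_nil])
  obtain ⟨T, m, hT⟩ := (A.spaceSweeper.toOfflineNTM_implements x).complete (x₀ := []) (K := K)
    (w := (l :: ls).map A.start) (y := .setup (some l')) (by simp) (by simp)
    (by
      rw [List.length_map, List.length_cons, List.range_succ_eq_map, List.map_cons, List.map_map]
      exact .cons ⟨none, l, rfl, rfl, rfl, hl⟩ hs) hK
  rw [← Sweeper.toOfflineNTM_init] at hT
  obtain ⟨R, hR⟩ := hT.exists_isRun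
  exact ⟨T, R, hR⟩

end Automaton

/-- As `t ≥ 1`, constants are absorbed: `max n 1 + C * t + 1 ≤ (C + 2) * (n + t)` and `t + 2 ≤ 3 *
t`. Replacing `t` by `c * F` costs the factor `(1 + c) * c`. Positivity of `F` follows from `1 ≤ t ≤
c * F`. -/
theorem time_bound {n t T C : ℕ} {c F : ℝ} (hc : 0 < c) (ht : 1 ≤ t) (htF : (t : ℝ) ≤ c * F)
    (hT : T ≤ 2 * (max n 1 + C * t + 1) * (t + 2)) :
    (T : ℝ) ≤ 6 * (C + 2) * ((1 + c) * c) * (((n : ℝ) + F) * F) := by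
  have h1 : T ≤ 6 * (C + 2) * ((n + t) * t) := by
    have h2 : max n 1 + C * t + 1 ≤ (C + 2) * (n + t) := by
      have : max n 1 ≤ n + 1 := by omega
      nlinarith [Nat.zero_le (C * n)]
    calc T ≤ 2 * ((C + 2) * (n + t)) * (3 * t) :=
          hT.trans (Nat.mul_le_mul (Nat.mul_le_mul le_rfl h2) (by omega))
      _ = _ := by ring
  have ht' : (1 : ℝ) ≤ t := by exact_mod_cast ht
  have hF : 0 < F := by
    by_contra hF
    have := mul_nonpos_of_nonneg_of_nonpos hc.le (not_lt.1 hF)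
    linarith
  have h3 : ((n : ℝ) + t) * t ≤ (1 + c) * (n + F) * (c * F) := by
    have hn : (0 : ℝ) ≤ n := n.cast_nonneg
    refine mul_le_mul ?_ htF (by linarith) (by positivity)
    nlinarith [mul_nonneg hc.le hn]
  calc (T : ℝ) ≤ 6 * (C + 2) * ((n + t) * t) := by exact_mod_cast h1
    _ ≤ 6 * (C + 2) * ((1 + c) * (n + F) * (c * F)) := by gcongr
    _ = _ := by ring

theorem nonempty_automaton (M : NARM σ) : Nonempty M.Automaton := by
  obtain ⟨Z, hZ, lab, start, step, acc, h1, h2, h3⟩ := M.exists_automaton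
  exact ⟨{ Z, finite := hZ, lab, start, step, acc, lab_start := h1, lab_step := h2, acc_iff := h3 }⟩

end NARM

end ARM

theorem mainTheorem3 {σ : Type} [Finite σ] (f : ℕ → ℝ) :
    ARM.NAL σ f ⊆ ARM.NSPACE σ f ∩ ARM.NTIME σ (fun n => ((n : ℝ) + f n) * f n) := by
  rintro _ ⟨M, rfl, c, hc, n₀, hM⟩
  obtain ⟨A⟩ := M.nonempty_automaton
  constructor
  · refine ⟨A.spaceSweeper.toOfflineNTM, ?_, 2 * c, by positivity, n₀, fun x hx T R hR i hi => ?_⟩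
    · ext x
      constructor
      · rintro ⟨T, R, hR⟩
        obtain ⟨t, r, hr, -⟩ := A.spaceNTM_sound hR
        exact ⟨t, r, hr⟩
      · rintro ⟨t, r, hr⟩
        exact A.spaceNTM_complete hr
    · obtain ⟨t, r, hr, ht, hi'⟩ := A.spaceNTM_sound hR
      have h1 := hM x hx t r hr
      -- The cells `0, …, t` number `t + 1 ≤ 2 * t`, hence the constant `2 * c`.
      have h2 : (((R i).workHead + 1 : ℕ) : ℝ) ≤ (2 * t : ℕ) := by
        have := hi' i hi
        exact_mod_cast (by omega : (R i).workHead + 1 ≤ 2 * t)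
      push_cast at h2 ⊢
      linarith
  · obtain ⟨C, hC⟩ := M.exists_regRun_bound
    refine ⟨A.timeSweeper.toNTM, ?_, 6 * (C + 2) * ((1 + c) * c), by positivity, n₀,
      fun x hx T R hR => ?_⟩
    · ext x
      constructor
      · rintro ⟨T, R, hR⟩
        obtain ⟨t, r, hr, -⟩ := A.timeNTM_sound hC hR
        exact ⟨t, r, hr⟩
      · rintro ⟨t, r, hr⟩
        exact A.timeNTM_complete hr
    · obtain ⟨t, r, hr, ht, hT⟩ := A.timeNTM_sound hC hR
      exact ARM.NARM.time_bound hc ht (hM x hx t r hr) hT
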